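/- Let $d$ be a non-negative integer and let $\omega:[0,+\infty)\to[0,+\infty)$ be a non-quasianalytic subadditive weight function, that is, a continuous increasing (i.e. non-decreasing) function such that $\omega(t_1+t_2)\le\omega(t_1)+\omega(t_2)$ for all $t_1,t_2\ge0$, $\int_1^{\infty}\omega(t)t^{-2}\,dt<\infty$, $\log t=o(\omega(t))$ as $t\to+\infty$, and $\varphi_\omega(t):=\omega(e^t)$ is convex. Put $\omega(x):=\omega(|x|)$ for $x\in\mathbb R^d$ and $\varphi^*_\omega(s):=\sup_{t\ge0}\{ts-\varphi_\omega(t)\}$, and write $\hat f(\xi)=\int e^{-i\langle x,\xi\rangle}f(x)\,dx$. Let $\mathcal S_\omega(\mathbb R^d)$ be the set of all $u\in\mathcal S(\mathbb R^d)$ such that $\sup_x e^{\lambda\omega(x)}|\partial^\alpha u(x)|<\infty$ and $\sup_\xi e^{\lambda\omega(\xi)}|\partial^\alpha\hat u(\xi)|<\infty$ for all $\lambda>0$ and $\alpha\in\mathbb N_0^d$. For $m\in\mathbb R$ let $S^m_\omega$ be the set of all $a\in C^\infty(\mathbb R^{2d})$ such that for all $\lambda,\mu>0$ there is $C_{\lambda,\mu}>0$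 with $$|\partial_x^\alpha\partial_\xi^\beta a(x,\xi)|\le C_{\lambda,\mu}\,e^{\lambda\varphi^*_\omega(|\alpha|/\lambda)}\,e^{\mu\varphi^*_\omega(|\beta|/\mu)}\,e^{m\omega(\xi)}\qquad\text{for all }(x,\xi)\in\mathbb R^{2d},\ \alpha,\beta\in\mathbb N_0^d .$$ Let $m\in\mathbb R$, $a\in S^m_\omega$, and let $\varphi\in\mathcal S_\omega(\mathbb R^d)$ with $\|\varphi\|_{L^2}=1$. For $z'=(y',\eta')$ and $z=(y,\eta)$ in $\mathbb R^{2d}$ let $$K(z',z)=(2\pi)^{-2d}e^{i\langle y,\eta\rangle}\int_{\mathbb R^{2d}}e^{i(\langle x,\xi\rangle-\langle y,\xi\rangle-\langle x,\eta'\rangle)}a(x,\xi)\,\hat\varphi(\xi-\eta)\,\overline{\varphi(x-y')}\,dx\,d\xi$$ be the kernel of the Kohn–Nirenberg operator $a(x,D)$ with respect to the short-time Fourier transform with window $\varphi$. Then the integral converges absolutely for all $z',z$, $K\in C^\infty(\mathbb R^{4d})$, and for every $\lambda>0$ there is a constant $C_\lambda>0$ such that $$|K(z',z)|\le C_\lambda\,e^{-\lambda\omega(y-y')}\,e^{(m-\lambda)\omega(\eta-\eta')}\,e^{m\omega(\eta')}\qquad\text{for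 all }z=(y,\eta),\ z'=(y',\eta')\in\mathbb R^{2d}.$$ Moreover, if $\Gamma\subseteq\mathbb R^{2d}\setminus\{0\}$ is an open conic set and $R>0$ is such that $a(z)=0$ for all $z\in\Gamma$ with $|z|>R$, then for every open conic set $\Gamma'\subseteq\mathbb R^{2d}\setminus\{0\}$ such that the closure of $\{z\in\Gamma':|z|=1\}$ is contained in $\Gamma$, and for every $\lambda>0$, there is a constant $C_\lambda>0$ such that $$|K(z',z)|\le C_\lambda\,e^{-\lambda\omega(y-y')}\,e^{-\lambda\omega(\eta-\eta')}\,e^{-2\lambda\omega(y')}\,e^{-2\lambda\omega(\eta')}\qquad\text{for all }z'=(y',\eta')\in\Gamma',\ z=(y,\eta)\in\mathbb R^{2d}.$$ -/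

import Mathlib

open MeasureTheory Set
open scoped SchwartzMap

namespace OmegaSTFT

noncomputable section

/-- The Euclidean space `ℝ^d`. -/
abbrev E (d : ℕ) : Type := EuclideanSpace ℝ (Fin d)

/-- Phase space `ℝ^{2d} = ℝ^d × ℝ^d` with its Euclidean norm `(|x|² + |ξ|²)^{1/2}`. -/
abbrev PhaseSpace (d : ℕ) : Type := WithLp 2 (E d × E d)

/-- Non-quasianalytic subadditive weight functions `ω : [0, ∞) → [0, ∞)`. Only the values of `ω` on
`[0, ∞)` matter; `ω` is extended to `ℝ^d` by `ω(x) = ω(|x|)`. -/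
structure IsWeightFunction (ω : ℝ → ℝ) : Prop where
  continuousOn : ContinuousOn ω (Ici 0)
  monotoneOn : MonotoneOn ω (Ici 0)
  nonneg : ∀ t, 0 ≤ t → 0 ≤ ω t
  /-- `(α)` -/
  subadditive : ∀ s t, 0 ≤ s → 0 ≤ t → ω (s + t) ≤ ω s + ω t
  /-- `(β)` -/
  integrable : IntegrableOn (fun t => ω t / t ^ 2) (Ioi 1)
  /-- `(γ)` -/
  log_isLittleO : Real.log =o[Filter.atTop] ω
  /-- `(δ)` -/
  convex : ConvexOn ℝ univ (fun t => ω (Real.exp t))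

/-- The Young conjugate `φ*_ω(s) = sup_{t ≥ 0} (t s - φ_ω(t))` of `φ_ω(t) = ω(e^t)`. -/
def youngConj (ω : ℝ → ℝ) (s : ℝ) : ℝ :=
  sSup ((fun t => t * s - ω (Real.exp t)) '' Ici 0)

variable {d : ℕ}

/-- The partial derivative `∂_i f`. -/
def partialDeriv (i : Fin d) (f : E d → ℂ) : E d → ℂ :=
  fun x => lineDeriv ℝ f x (EuclideanSpace.single i 1)

/-- The partial derivative `∂^α f = ∂_1^{α_1} ⋯ ∂_d^{α_d} f` of multi-index `α`. -/
def multiDeriv (α : Fin d → ℕ) (f : E d → ℂ) : E d → ℂ :=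
  (List.finRange d).foldr (fun i g => (partialDeriv i)^[α i] g) f

/-- The length `|α| = α_1 + ⋯ + α_d` of a multi-index, as a real number. -/
def multiLength (α : Fin d → ℕ) : ℝ := ((∑ i, α i : ℕ) : ℝ)

/-- The Fourier transform `∫ e^{-i⟨x, ξ⟩} f(x) dx`. -/
def fourierHat (f : E d → ℂ) (ξ : E d) : ℂ :=
  ∫ x, Complex.exp (-(Complex.I * (inner ℝ x ξ : ℝ))) * f x

/-- The space `S_ω(ℝ^d)`: Schwartz functions `u` such that, for all `l > 0` and all multi-indices
`α`, the functions `e^{l ω} |∂^α u|` and `e^{l ω} |∂^α û|` are bounded. -/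
def weightedSchwartz (d : ℕ) (ω : ℝ → ℝ) : Set 𝓢(E d, ℂ) :=
  {u | (∀ l : ℝ, 0 < l → ∀ α : Fin d → ℕ, ∃ C : ℝ, ∀ x : E d,
          Real.exp (l * ω ‖x‖) * ‖multiDeriv α u x‖ ≤ C) ∧
       (∀ l : ℝ, 0 < l → ∀ α : Fin d → ℕ, ∃ C : ℝ, ∀ ξ : E d,
          Real.exp (l * ω ‖ξ‖) * ‖multiDeriv α (fourierHat u) ξ‖ ≤ C)}

/-- The derivative `∂_x^α ∂_ξ^β a (x, ξ)`. -/
def mixedDeriv (α β : Fin d → ℕ) (a : E d × E d → ℂ) (x ξ : E d) : ℂ :=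
  multiDeriv α (fun x' => multiDeriv β (fun ξ' => a (x', ξ')) ξ) x

/-- The symbol class `S^m_ω`. -/
def symbolClass (d : ℕ) (ω : ℝ → ℝ) (m : ℝ) : Set (E d × E d → ℂ) :=
  {a | ContDiff ℝ ((⊤ : ℕ∞) : WithTop ℕ∞) a ∧
    ∀ l μ : ℝ, 0 < l → 0 < μ → ∃ C : ℝ, 0 < C ∧
      ∀ (α β : Fin d → ℕ) (x ξ : E d),
        ‖mixedDeriv α β a x ξ‖ ≤
          C * Real.exp (l * youngConj ω (multiLength α / l)) *
            Real.exp (μ * youngConj ω (multiLength β / μ)) * Real.exp (m * ω ‖ξ‖)}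

/-- The function of `(x, ξ)` that is integrated in the STFT kernel:
`e^{i(⟨x, ξ⟩ - ⟨y, ξ⟩ - ⟨x, η'⟩)} a(x, ξ) φ̂(ξ - η) conj φ(x - y')`,
where `z' = (y', η')` and `z = (y, η)`. -/
def kernelIntegrand (φ : E d → ℂ) (a : E d × E d → ℂ) (z' z : E d × E d) (p : E d × E d) : ℂ :=
  Complex.exp (Complex.I *
      ((inner ℝ p.1 p.2 - inner ℝ z.1 p.2 - inner ℝ p.1 z'.2 : ℝ) : ℂ)) *
    a p * fourierHat φ (p.2 - z.2) * starRingEnd ℂ (φ (p.1 - z'.1))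

/-- The STFT kernel `K(z', z)` of the Kohn–Nirenberg operator `a(x, D)`, for the window `φ`:
`(2π)^{-2d} e^{i⟨y, η⟩} ∫ e^{i(⟨x, ξ⟩ - ⟨y, ξ⟩ - ⟨x, η'⟩)} a(x, ξ) φ̂(ξ - η) conj φ(x - y') dx dξ`. -/
def stftKernel (φ : E d → ℂ) (a : E d × E d → ℂ) (z' z : E d × E d) : ℂ :=
  ((2 * Real.pi : ℝ) : ℂ) ^ (-(2 * d : ℤ)) *
    Complex.exp (Complex.I * ((inner ℝ z.1 z.2 : ℝ) : ℂ)) *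
    ∫ p : E d × E d, kernelIntegrand φ a z' z p

/-- Open conic subsets of `ℝ^{2d} ∖ {0}`. -/
structure IsOpenCone (Γ : Set (PhaseSpace d)) : Prop where
  isOpen : IsOpen Γ
  zero_notMem : (0 : PhaseSpace d) ∉ Γ
  smul_mem : ∀ z ∈ Γ, ∀ t : ℝ, 0 < t → t • z ∈ Γ

end

end OmegaSTFT

open OmegaSTFT

/-! Moving a weight between points is cheap: by subadditivity `ω(x)` and `ω(y)` differ by at most
`ω(x - y)`. The modulus of the integrand is `|a(x,ξ)| |φ̂(ξ-η)| |φ(x-y')|`, so the decay of the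
windows gives absolute convergence, and dominated differentiation gives smoothness.

For the off-diagonal estimate the double integral is read in two ways. Integrating in `ξ` first, the
inner integral is the Fourier transform of `a(x,·) φ̂(·-η)` at `y - x`; this yields `e^{mω(η) -
lω(y-y')}` (`exists_stftKernel_le_fst`). Integrating in `x` first gives the transform of `a(·,ξ)`
times the conjugate of `φ(·-y')` at `η' - ξ`, hence `e^{mω(η') - lω(η-η')}`
(`exists_stftKernel_le_snd`). With `l` arbitrary, the geometric mean of the two bounds
(`le_exp_half_add`) is the claim, so mixed derivatives of `a` are never needed.

The Fourier decay comes from pure derivatives `∂_j^k` alone: bounds by `weightSeq ω l k` for all `k`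
give decay `e^{-lω}` by convex duality, applied to the largest coordinate. The product of symbol and
window needs such bounds for the window with decay in `x` as well. Membership in `S_ω` only gives
decay of the derivatives of `φ` and `φ̂` for each multi-index separately; `ultraBound_of_rapidDecay`
upgrades this by localizing with a Gaussian.

For the cone estimate, a point `p` with `a(p) ≠ 0` lies outside `Γ` or in a ball, so `|z'|` is
bounded by a multiple of `|p - z'| + R` when `z' ∈ Γ'`. Window decay around `z'` thus becomes decay
in `z'`, at the price of growth in `η - η'`, which another geometric mean with the off-diagonal
estimate removes. -/

namespace OmegaSTFT

noncomputable section

open scoped FourierTransform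

local notation "∞" => ((⊤ : ℕ∞) : WithTop ℕ∞)

/-! ### Growth of weight functions -/

namespace IsWeightFunction

variable {ω : ℝ → ℝ} {d : ℕ}

lemma mono (hω : IsWeightFunction ω) {s t : ℝ} (hs : 0 ≤ s) (hst : s ≤ t) : ω s ≤ ω t :=
  hω.monotoneOn hs (hs.trans hst) hst

lemma nonneg_norm (hω : IsWeightFunction ω) {F : Type*} [SeminormedAddCommGroup F] (x : F) :
    0 ≤ ω ‖x‖ := hω.nonneg _ (norm_nonneg x)

lemma norm_add_le (hω : IsWeightFunction ω) {F : Type*} [SeminormedAddCommGroup F] (x y : F) :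
    ω ‖x + y‖ ≤ ω ‖x‖ + ω ‖y‖ :=
  (hω.mono (norm_nonneg _) (_root_.norm_add_le x y)).trans
    (hω.subadditive _ _ (norm_nonneg _) (norm_nonneg _))

lemma norm_le_add_sub (hω : IsWeightFunction ω) {F : Type*} [SeminormedAddCommGroup F] (x y : F) :
    ω ‖x‖ ≤ ω ‖y‖ + ω ‖x - y‖ := by
  simpa using hω.norm_add_le y (x - y)

lemma natCast_mul_le (hω : IsWeightFunction ω) (n : ℕ) {t : ℝ} (ht : 0 ≤ t) :
    ω ((n + 1 : ℕ) * t) ≤ (n + 1 : ℕ) * ω t := by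
  induction n with
  | zero => simp
  | succ n ih =>
    have h := hω.subadditive ((n + 1 : ℕ) * t) t (by positivity) ht
    have e : ((n + 1 + 1 : ℕ) : ℝ) * t = (n + 1 : ℕ) * t + t := by push_cast; ring
    rw [e]
    refine h.trans ?_
    push_cast at ih ⊢
    linarith

lemma le_linear (hω : IsWeightFunction ω) {t : ℝ} (ht : 0 ≤ t) : ω t ≤ ω 1 * (t + 1) := by
  have h := hω.natCast_mul_le ⌊t⌋₊ (zero_le_one)
  have h1 := Nat.lt_floor_add_one t
  have h2 := Nat.floor_le ht
  have h3 := hω.nonneg 1 zero_le_one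
  calc ω t ≤ ω ((⌊t⌋₊ + 1 : ℕ) * 1) := hω.mono ht (by push_cast; linarith)
    _ ≤ (⌊t⌋₊ + 1 : ℕ) * ω 1 := h
    _ ≤ _ := by push_cast; nlinarith

lemma exists_log_le (hω : IsWeightFunction ω) {ε : ℝ} (hε : 0 < ε) :
    ∃ C : ℝ, 0 ≤ C ∧ ∀ t, 1 ≤ t → Real.log t ≤ ε * ω t + C := by
  obtain ⟨T, hT⟩ := Filter.eventually_atTop.1 (hω.log_isLittleO.def hε)
  refine ⟨Real.log (max T 1), Real.log_nonneg (le_max_right _ _), fun t ht => ?_⟩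
  have h0 := hω.nonneg t (by linarith)
  rcases le_total T t with h | h
  · have := hT t h
    rw [Real.norm_of_nonneg (Real.log_nonneg ht), Real.norm_of_nonneg h0] at this
    linarith [Real.log_nonneg (le_max_right T 1)]
  · have := Real.log_le_log (by linarith) (h.trans (le_max_left T 1))
    have : 0 ≤ ε * ω t := by positivity
    linarith

/-- Condition (γ) makes a polynomial factor cost only an arbitrarily small multiple of `ω` in the
exponent. -/
lemma exists_one_add_pow_le (hω : IsWeightFunction ω) (n : ℕ) {l : ℝ} (hl : 0 < l) :
    ∃ C : ℝ, 0 < C ∧ ∀ t, 0 ≤ t → (1 + t) ^ n ≤ C * Real.exp (l * ω t) := by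
  obtain ⟨C, hC, h⟩ := hω.exists_log_le (ε := l / (n + 1)) (by positivity)
  refine ⟨Real.exp (n * C + l * ω 1), by positivity, fun t ht => ?_⟩
  have h1 := h (1 + t) (by linarith)
  have h2 := hω.subadditive 1 t zero_le_one ht
  have h3 := hω.nonneg (1 + t) (by linarith)
  rw [← Real.exp_add, ← Real.exp_log (show 0 < 1 + t by linarith), ← Real.exp_nat_mul]
  refine Real.exp_le_exp.2 ?_
  calc n * Real.log (1 + t) ≤ n * (l / (n + 1) * ω (1 + t) + C) := by gcongr
    _ = (n / (n + 1)) * (l * ω (1 + t)) + n * C := by ring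
    _ ≤ 1 * (l * ω (1 + t)) + n * C := by
        gcongr
        rw [div_le_one (by positivity)]; linarith
    _ ≤ _ := by nlinarith

lemma continuous_norm (hω : IsWeightFunction ω) {F : Type*} [SeminormedAddCommGroup F] :
    Continuous fun x : F => ω ‖x‖ :=
  hω.continuousOn.comp_continuous _root_.continuous_norm fun x => norm_nonneg x

lemma integrable_exp_neg (hω : IsWeightFunction ω) {l : ℝ} (hl : 0 < l) :
    Integrable fun x : E d => Real.exp (-l * ω ‖x‖) := by
  obtain ⟨C, hC, h⟩ := hω.exists_one_add_pow_le (d + 1) hl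
  have hi : Integrable fun x : E d => (1 + ‖x‖) ^ (-((d + 1 : ℕ) : ℝ)) :=
    integrable_one_add_norm (by simp)
  refine (hi.const_mul C).mono' ?_ (Filter.Eventually.of_forall fun x => ?_)
  · exact (Real.continuous_exp.comp (continuous_const.mul hω.continuous_norm)).aestronglyMeasurable
  · have := h ‖x‖ (norm_nonneg x)
    rw [Real.norm_of_nonneg (by positivity), Real.rpow_neg (by positivity), Real.rpow_natCast,
      neg_mul, Real.exp_neg, ← div_eq_mul_inv, inv_le_comm₀ (by positivity) (by positivity),
      inv_div, div_le_iff₀ hC]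
    linarith

end IsWeightFunction

/-! ### Young conjugate and weight sequence -/

/-- The weight sequence `k ↦ exp (l φ*_ω(k / l)) = sup_{t ≥ 1} t ^ k exp (-l ω(t))`. -/
def weightSeq (ω : ℝ → ℝ) (l : ℝ) (k : ℕ) : ℝ := Real.exp (l * youngConj ω (k / l))

lemma weightSeq_pos (ω : ℝ → ℝ) (l : ℝ) (k : ℕ) : 0 < weightSeq ω l k := Real.exp_pos _

namespace IsWeightFunction

variable {ω : ℝ → ℝ}

lemma bddAbove_youngConj (hω : IsWeightFunction ω) (s : ℝ) :
    BddAbove ((fun t => t * s - ω (Real.exp t)) '' Ici 0) := by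
  obtain ⟨C, hC, h⟩ := hω.exists_log_le (ε := 1 / (|s| + 1)) (by positivity)
  refine ⟨(|s| + 1) * C, ?_⟩
  rintro _ ⟨t, ht, rfl⟩
  have h1 := h (Real.exp t) (Real.one_le_exp ht)
  rw [Real.log_exp] at h1
  have h2 : (|s| + 1) * t ≤ ω (Real.exp t) + (|s| + 1) * C := by
    calc (|s| + 1) * t ≤ (|s| + 1) * (1 / (|s| + 1) * ω (Real.exp t) + C) := by gcongr
      _ = _ := by field_simp
  have h3 : t * s ≤ |s| * t := by rw [mul_comm]; exact mul_le_mul_of_nonneg_right (le_abs_self s) ht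
  have h4 : (0:ℝ) ≤ t := ht
  simp only
  nlinarith

lemma le_youngConj (hω : IsWeightFunction ω) (s : ℝ) {t : ℝ} (ht : 0 ≤ t) :
    t * s - ω (Real.exp t) ≤ youngConj ω s :=
  le_csSup (hω.bddAbove_youngConj s) ⟨t, ht, rfl⟩

lemma youngConj_le {s D : ℝ} (h : ∀ t, 0 ≤ t → t * s - ω (Real.exp t) ≤ D) :
    youngConj ω s ≤ D :=
  csSup_le (nonempty_Ici.image _) (by rintro _ ⟨t, ht, rfl⟩; exact h t ht)

lemma youngConj_mono (hω : IsWeightFunction ω) : Monotone (youngConj ω) := fun s s' h =>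
  youngConj_le fun t ht => (hω.le_youngConj s' ht).trans' (by gcongr)

/-- With `weightSeq_le`, this characterizes the sequence as a supremum over `t ≥ 1`, via the
substitution `t ↦ log t`. -/
lemma pow_mul_exp_le_weightSeq (hω : IsWeightFunction ω) {l : ℝ} (hl : 0 < l) (k : ℕ) {t : ℝ}
    (ht : 1 ≤ t) : t ^ k * Real.exp (-l * ω t) ≤ weightSeq ω l k := by
  have ht0 : 0 < t := by linarith
  have h := hω.le_youngConj (k / l) (Real.log_nonneg ht)
  rw [Real.exp_log ht0] at h
  rw [← Real.exp_log ht0, ← Real.exp_nat_mul, Real.exp_log ht0, ← Real.exp_add, weightSeq]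
  refine Real.exp_le_exp.2 ?_
  calc k * Real.log t + -l * ω t = l * (Real.log t * (k / l) - ω t) := by field_simp; ring
    _ ≤ _ := by gcongr

lemma weightSeq_le {l : ℝ} (hl : 0 < l) {k : ℕ} {D : ℝ}
    (h : ∀ t, 1 ≤ t → t ^ k * Real.exp (-l * ω t) ≤ D) : weightSeq ω l k ≤ D := by
  have hD : 0 < D := (h 1 le_rfl).trans_lt' (by positivity)
  rw [weightSeq, ← Real.exp_log hD]
  refine Real.exp_le_exp.2 ?_
  have : youngConj ω (k / l) ≤ Real.log D / l := by
    refine youngConj_le fun t ht => ?_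
    have h1 := h _ (Real.one_le_exp ht)
    rw [← Real.exp_nat_mul, ← Real.exp_add, ← Real.le_log_iff_exp_le hD] at h1
    rw [le_div_iff₀ hl]
    calc (t * (k / l) - ω (Real.exp t)) * l = k * t + -l * ω (Real.exp t) := by field_simp; ring
      _ ≤ _ := h1
  rw [le_div_iff₀ hl] at this
  linarith

/-- In a product of two values at `s ≤ t`, replacing `s` by `t` in the power and dropping
`e^{-lω(s)} ≤ 1` leaves a competitor for the supremum of order `i + j`. -/
lemma weightSeq_mul_le (hω : IsWeightFunction ω) {l : ℝ} (hl : 0 < l) (i j : ℕ) :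
    weightSeq ω l i * weightSeq ω l j ≤ weightSeq ω l (i + j) := by
  rw [← le_div_iff₀ (weightSeq_pos _ _ _)]
  refine weightSeq_le hl fun t ht => ?_
  rw [le_div_iff₀ (weightSeq_pos _ _ _), mul_comm, ← le_div_iff₀ (by positivity)]
  refine weightSeq_le hl fun s hs => ?_
  rw [le_div_iff₀ (by positivity)]
  have key : ∀ {i j : ℕ} {s t : ℝ}, 1 ≤ s → s ≤ t →
      s ^ j * Real.exp (-l * ω s) * (t ^ i * Real.exp (-l * ω t)) ≤ weightSeq ω l (i + j) := by
    intro i j s t hs hst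
    refine (hω.pow_mul_exp_le_weightSeq hl (i + j) (hs.trans hst)).trans' ?_
    have h1 : Real.exp (-l * ω s) ≤ 1 :=
      Real.exp_le_one_iff.2 (by nlinarith [hω.nonneg s (by linarith)])
    have h0 : 0 ≤ t := by linarith
    calc s ^ j * Real.exp (-l * ω s) * (t ^ i * Real.exp (-l * ω t))
        ≤ t ^ j * 1 * (t ^ i * Real.exp (-l * ω t)) := by gcongr
      _ = _ := by ring
  rcases le_total s t with h | h
  · exact key hs h
  · rw [mul_comm, add_comm]; exact key ht h

/-- Substituting `(n+1)t` for `t` in the supremum and using `ω((n+1)t) ≤ (n+1)ω(t)`. Geometric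
factors, such as the `2^k` of Leibniz' rule, are thus absorbed by enlarging `l`. -/
lemma pow_mul_weightSeq_le (hω : IsWeightFunction ω) {l : ℝ} (hl : 0 < l) (n k : ℕ) :
    ((n + 1 : ℕ) : ℝ) ^ k * weightSeq ω ((n + 1 : ℕ) * l) k ≤ weightSeq ω l k := by
  rw [mul_comm, ← le_div_iff₀ (by positivity)]
  refine weightSeq_le (by positivity) fun t ht => ?_
  rw [le_div_iff₀ (by positivity)]
  have hn : (1 : ℝ) ≤ (n + 1 : ℕ) := by push_cast; linarith [n.cast_nonneg (α := ℝ)]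
  refine (hω.pow_mul_exp_le_weightSeq hl k (t := (n + 1 : ℕ) * t) (by nlinarith)).trans' ?_
  have := hω.natCast_mul_le n (t := t) (by linarith)
  rw [mul_pow]
  calc t ^ k * Real.exp (-((n + 1 : ℕ) * l) * ω t) * ((n + 1 : ℕ) : ℝ) ^ k
      = ((n + 1 : ℕ) : ℝ) ^ k * t ^ k * Real.exp (-((n + 1 : ℕ) * l) * ω t) := by ring
    _ ≤ _ := by
      gcongr ?_ * Real.exp ?_
      nlinarith

lemma exp_neg_le_weightSeq (hω : IsWeightFunction ω) {l : ℝ} (hl : 0 < l) (k : ℕ) :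
    Real.exp (-l * ω 1) ≤ weightSeq ω l k := by
  simpa using hω.pow_mul_exp_le_weightSeq hl k le_rfl

/-- The factor `e^{lω(1)}` pays for `s < 1`, a range not seen by the supremum. -/
lemma pow_mul_exp_le (hω : IsWeightFunction ω) {l : ℝ} (hl : 0 < l) (k : ℕ) {s t : ℝ}
    (hs : 0 ≤ s) (hst : s ≤ t) :
    s ^ k * Real.exp (-l * ω t) ≤ Real.exp (l * ω 1) * weightSeq ω l k := by
  have h1 := hω.nonneg 1 zero_le_one
  have h2 := hω.nonneg t (hs.trans hst)
  rcases le_total 1 s with h | h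
  · calc s ^ k * Real.exp (-l * ω t) ≤ s ^ k * Real.exp (-l * ω s) := by
          gcongr ?_ * Real.exp ?_
          have := hω.mono hs hst
          nlinarith
      _ ≤ 1 * weightSeq ω l k := by simpa using hω.pow_mul_exp_le_weightSeq hl k h
      _ ≤ _ := by
          gcongr
          · exact (weightSeq_pos _ _ _).le
          · exact Real.one_le_exp (by positivity)
  · calc s ^ k * Real.exp (-l * ω t) ≤ 1 * 1 := by
          gcongr
          · exact pow_le_one₀ hs h
          · exact Real.exp_le_one_iff.2 (by nlinarith)
      _ = Real.exp (l * ω 1) * Real.exp (-l * ω 1) := by rw [← Real.exp_add]; simp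
      _ ≤ _ := by gcongr; exact hω.exp_neg_le_weightSeq hl k

/-- Since `ω` grows at most linearly, testing the supremum at `t = k + 1` costs only a geometric
factor. Hence Cauchy estimates for analytic functions give ultradifferentiable bounds. -/
lemma exists_factorial_le (hω : IsWeightFunction ω) {l : ℝ} (hl : 0 < l) :
    ∃ C r : ℝ, 0 < C ∧ 0 < r ∧ ∀ k : ℕ, (k.factorial : ℝ) ≤ C * r ^ k * weightSeq ω l k := by
  have h1 := hω.nonneg 1 zero_le_one
  refine ⟨Real.exp (2 * (l * ω 1)), Real.exp (l * ω 1), by positivity, by positivity, fun k => ?_⟩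
  have hk : (k.factorial : ℝ) ≤ (k + 1 : ℝ) ^ k := by
    refine (Nat.cast_le.2 (Nat.factorial_le_pow k)).trans ?_
    push_cast
    gcongr; linarith
  have h2 := hω.pow_mul_exp_le_weightSeq hl k (t := k + 1) (by linarith [k.cast_nonneg (α := ℝ)])
  have h3 := hω.le_linear (t := k + 1) (by positivity)
  refine hk.trans ?_
  calc (k + 1 : ℝ) ^ k = Real.exp (l * ω (k + 1)) * ((k + 1) ^ k * Real.exp (-l * ω (k + 1))) := by
        rw [mul_left_comm, ← Real.exp_add]; simp
    _ ≤ Real.exp (2 * (l * ω 1) + k * (l * ω 1)) * weightSeq ω l k := by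
        gcongr
        nlinarith
    _ = _ := by rw [Real.exp_add, Real.exp_nat_mul]

/-- Subgradients of the convex function `t ↦ ω (exp t)` are nonnegative and realise its
biconjugate. -/
lemma exists_youngConj_le (hω : IsWeightFunction ω) (t : ℝ) :
    ∃ s, 0 ≤ s ∧ youngConj ω s ≤ t * s - ω (Real.exp t) := by
  have hc := hω.convex
  have hi : t ∈ interior (univ : Set ℝ) := by simp
  set f := fun t => ω (Real.exp t) with hf
  have hsub : ∀ u, f t + derivWithin f (Ioi t) t * (u - t) ≤ f u := by
    intro u
    rcases lt_trichotomy t u with h | rfl | h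
    · have := hc.rightDeriv_le_slope_of_mem_interior hi (mem_univ u) h
      rw [slope_def_field, le_div_iff₀ (by linarith)] at this
      linarith
    · simp
    · have h1 := hc.slope_le_leftDeriv_of_mem_interior (mem_univ u) hi h
      have := h1.trans (hc.leftDeriv_le_rightDeriv_of_mem_interior hi)
      rw [slope_def_field, div_le_iff₀ (by linarith)] at this
      linarith
  -- The right derivative is a subgradient, nonnegative because `ω` is monotone.
  refine ⟨derivWithin f (Ioi t) t, ?_, youngConj_le fun u _ => ?_⟩
  · have h1 := hsub (t - 1)
    have h2 : f (t - 1) ≤ f t := hω.mono (Real.exp_pos _).le (Real.exp_le_exp.2 (by linarith))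
    linarith
  · have := hsub u
    simp only [hf] at this ⊢
    linarith

/-- Optimizing over real `k` would give `e^{-lω(t)}` exactly, by biconjugation; restricting to
integers costs one factor `t`. -/
lemma le_exp_of_pow_mul_le (hω : IsWeightFunction ω) {l : ℝ} (hl : 0 < l) {t F C : ℝ}
    (ht : 1 ≤ t) (hC : 0 ≤ C) (h : ∀ k : ℕ, t ^ k * F ≤ C * weightSeq ω l k) :
    F ≤ C * t * Real.exp (-l * ω t) := by
  have ht0 : 0 < t := by linarith
  obtain ⟨s, hs, hy⟩ := hω.exists_youngConj_le (Real.log t)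
  rw [Real.exp_log ht0] at hy
  -- `l * s` is the optimal real order; rounding down keeps `φ*(k/l) ≤ φ*(s)`.
  set k := ⌊l * s⌋₊
  have hk1 : (k : ℝ) ≤ l * s := Nat.floor_le (by positivity)
  have hk2 : l * s < k + 1 := Nat.lt_floor_add_one _
  have hM : weightSeq ω l k ≤ Real.exp (l * (Real.log t * s - ω t)) := by
    refine Real.exp_le_exp.2 ?_
    gcongr
    refine (hω.youngConj_mono ?_).trans hy
    rw [div_le_iff₀ hl]; linarith
  have h2 : t ^ k * F ≤ t ^ k * (C * t * Real.exp (-l * ω t)) := by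
    refine (h k).trans ((mul_le_mul_of_nonneg_left hM hC).trans ?_)
    have : t ^ k * (C * t * Real.exp (-l * ω t)) =
        C * Real.exp ((k + 1) * Real.log t - l * ω t) := by
      rw [sub_eq_add_neg, Real.exp_add, add_mul, Real.exp_add, Real.exp_nat_mul, one_mul,
        Real.exp_log ht0]
      ring_nf
    rw [this]
    gcongr
    nlinarith [Real.log_nonneg ht]
  exact le_of_mul_le_mul_left h2 (by positivity)

end IsWeightFunction

section

variable {d : ℕ}

/-! ### Pure partial derivatives as derivatives along lines -/

section PartialDeriv

lemma partialDeriv_iterate_line (j : Fin d) (k : ℕ) (f : E d → ℂ) (x : E d) (s : ℝ) :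
    (partialDeriv j)^[k] f (x + s • EuclideanSpace.single j 1) =
      iteratedDeriv k (fun s : ℝ => f (x + s • EuclideanSpace.single j 1)) s := by
  induction k generalizing s with
  | zero => simp
  | succ k ih =>
    rw [Function.iterate_succ_apply', iteratedDeriv_succ, ← funext ih, partialDeriv, lineDeriv,
      ← add_zero s, ← deriv_comp_const_add]
    simp only [add_zero, add_smul, add_assoc]

lemma partialDeriv_iterate_eq (j : Fin d) (k : ℕ) (f : E d → ℂ) (x : E d) :
    (partialDeriv j)^[k] f x =
      iteratedDeriv k (fun s : ℝ => f (x + s • EuclideanSpace.single j 1)) 0 := by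
  simpa using partialDeriv_iterate_line j k f x 0

lemma partialDeriv_eq_fderiv {f : E d → ℂ} (hf : Differentiable ℝ f) (j : Fin d) :
    partialDeriv j f = fun x => fderiv ℝ f x (EuclideanSpace.single j 1) :=
  funext fun x => (hf x).lineDeriv_eq_fderiv

lemma contDiff_partialDeriv {f : E d → ℂ} (hf : ContDiff ℝ ∞ f) (j : Fin d) :
    ContDiff ℝ ∞ (partialDeriv j f) := by
  rw [partialDeriv_eq_fderiv (hf.differentiable (by simp))]
  exact (hf.fderiv_right (m := ∞) (by simp)).clm_apply contDiff_const

lemma contDiff_partialDeriv_iterate {f : E d → ℂ} (hf : ContDiff ℝ ∞ f) (j : Fin d) (k : ℕ) :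
    ContDiff ℝ ∞ ((partialDeriv j)^[k] f) := by
  induction k with
  | zero => exact hf
  | succ k ih => rw [Function.iterate_succ_apply']; exact contDiff_partialDeriv ih j

lemma partialDeriv_iterate_comp_sub (j : Fin d) (k : ℕ) (f : E d → ℂ) (a x : E d) :
    (partialDeriv j)^[k] (fun x => f (x - a)) x = (partialDeriv j)^[k] f (x - a) := by
  simp only [partialDeriv_iterate_eq, add_sub_right_comm]

lemma partialDeriv_iterate_conj (j : Fin d) (k : ℕ) (f : E d → ℂ) :
    (partialDeriv j)^[k] (fun x => starRingEnd ℂ (f x)) =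
      fun x => starRingEnd ℂ ((partialDeriv j)^[k] f x) := by
  induction k with
  | zero => rfl
  | succ k ih =>
    rw [Function.iterate_succ_apply', Function.iterate_succ_apply', ih]
    funext x
    simp only [partialDeriv, lineDeriv, starRingEnd_apply]
    exact deriv.star

/-- The symbol estimates are used only for multi-indices with at most one nonzero entry. -/
lemma multiDeriv_single (j : Fin d) (k : ℕ) (f : E d → ℂ) :
    multiDeriv (Pi.single j k) f = (partialDeriv j)^[k] f := by
  have key : ∀ L : List (Fin d), L.Nodup →
      L.foldr (fun i g => (partialDeriv i)^[(Pi.single j k : Fin d → ℕ) i] g) f =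
        if j ∈ L then (partialDeriv j)^[k] f else f := by
    intro L hL
    induction L with
    | nil => simp
    | cons i L ih =>
      rw [List.nodup_cons] at hL
      rw [List.foldr_cons, ih hL.2]
      rcases eq_or_ne j i with rfl | h
      · simp [hL.1]
      · simp [h]
  rw [multiDeriv, key _ (List.nodup_finRange d), if_pos (List.mem_finRange j)]

lemma multiDeriv_zero (f : E d → ℂ) : multiDeriv 0 f = f := by
  have key : ∀ L : List (Fin d),
      L.foldr (fun i g => (partialDeriv i)^[(0 : Fin d → ℕ) i] g) f = f := by
    intro L
    induction L with
    | nil => rfl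
    | cons i L ih => rw [List.foldr_cons, ih]; rfl
  exact key _

lemma multiLength_single (j : Fin d) (k : ℕ) : multiLength (Pi.single j k) = k := by
  simp [multiLength]

lemma multiLength_zero : multiLength (0 : Fin d → ℕ) = 0 := by simp [multiLength]

end PartialDeriv

/-! ### Calculus of ultradifferentiable families -/

/-- Uniform ultradifferentiability of Beurling type `ω` of a family of functions, relative to a
family of weights. -/
def UltraBound (ω : ℝ → ℝ) {ι : Type*} (f : ι → E d → ℂ) (w : ι → E d → ℝ) : Prop :=
  ∀ l : ℝ, 0 < l → ∃ C : ℝ, 0 ≤ C ∧ ∀ i j k x,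
    ‖(partialDeriv j)^[k] (f i) x‖ ≤ C * weightSeq ω l k * w i x

namespace UltraBound

variable {ω : ℝ → ℝ} {ι : Type*} {f g : ι → E d → ℂ} {w v : ι → E d → ℝ}

/-- Leibniz' rule with factor bounds at the parameter `2l`: the binomial coefficients sum to `2^k`,
which is absorbed in passing from `2l` to `l`. -/
lemma mul (hω : IsWeightFunction ω) (hf : UltraBound ω f w) (hg : UltraBound ω g v)
    (hfs : ∀ i, ContDiff ℝ ∞ (f i)) (hgs : ∀ i, ContDiff ℝ ∞ (g i)) :
    UltraBound ω (fun i x => f i x * g i x) (fun i x => w i x * v i x) := by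
  intro l hl
  have h2l : 0 < ((1 + 1 : ℕ) : ℝ) * l := by positivity
  obtain ⟨A, hA, hfA⟩ := hf _ h2l
  obtain ⟨B, hB, hgB⟩ := hg _ h2l
  refine ⟨A * B, by positivity, fun i j k x => ?_⟩
  have hcd : ∀ {h : E d → ℂ}, ContDiff ℝ ∞ h → ContDiffAt ℝ k
      (fun s : ℝ => h (x + s • EuclideanSpace.single j 1)) 0 := fun h =>
    ((h.of_le (by exact_mod_cast le_top)).comp
      (contDiff_const.add (contDiff_id.smul contDiff_const))).contDiffAt
  have hL := iteratedDeriv_fun_mul (hcd (hfs i)) (hcd (hgs i))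
  simp only [← partialDeriv_iterate_eq] at hL
  rw [partialDeriv_iterate_eq, hL]
  -- Weights are not assumed nonnegative; the sign is read off from the bounds at `k = 0`.
  have h0 : 0 ≤ A * B * (w i x * v i x) := by
    have h1 := (norm_nonneg _).trans (hfA i j 0 x)
    have h2 := (norm_nonneg _).trans (hgB i j 0 x)
    have hM := weightSeq_pos ω (((1 + 1 : ℕ) : ℝ) * l) 0
    have h1' : 0 ≤ A * w i x := by
      rw [mul_right_comm] at h1; exact nonneg_of_mul_nonneg_left h1 hM
    have h2' : 0 ≤ B * v i x := by
      rw [mul_right_comm] at h2; exact nonneg_of_mul_nonneg_left h2 hM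
    calc 0 ≤ (A * w i x) * (B * v i x) := by positivity
      _ = _ := by ring
  calc ‖∑ n ∈ Finset.range (k + 1), (k.choose n : ℂ) * (partialDeriv j)^[n] (f i) x *
        (partialDeriv j)^[k - n] (g i) x‖
      ≤ ∑ n ∈ Finset.range (k + 1), (k.choose n : ℝ) *
          (A * B * (w i x * v i x) * weightSeq ω ((1 + 1 : ℕ) * l) k) := by
        refine norm_sum_le_of_le _ fun n hn => ?_
        rw [norm_mul, norm_mul, Complex.norm_natCast, mul_assoc]
        refine mul_le_mul_of_nonneg_left ?_ (by positivity)
        have hnk : n + (k - n) = k := by rw [Finset.mem_range] at hn; omega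
        have hM := hω.weightSeq_mul_le h2l n (k - n)
        rw [hnk] at hM
        refine (mul_le_mul (hfA i j n x) (hgB i j (k - n) x) (norm_nonneg _)
          ((norm_nonneg _).trans (hfA i j n x))).trans ?_
        calc _ = A * B * (w i x * v i x) *
              (weightSeq ω ((1 + 1 : ℕ) * l) n * weightSeq ω ((1 + 1 : ℕ) * l) (k - n)) := by ring
          _ ≤ _ := by gcongr
    _ = A * B * (w i x * v i x) *
          (((1 + 1 : ℕ) : ℝ) ^ k * weightSeq ω ((1 + 1 : ℕ) * l) k) := by
        rw [← Finset.sum_mul, ← Nat.cast_sum, Nat.sum_range_choose]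
        push_cast; ring
    _ ≤ A * B * (w i x * v i x) * weightSeq ω l k := by
        gcongr
        exact hω.pow_mul_weightSeq_le hl 1 k
    _ = _ := by ring

lemma mono (hf : UltraBound ω f w) {v : ι → E d → ℝ} {D : ℝ} (hD : 0 ≤ D)
    (h : ∀ i x, w i x ≤ D * v i x) : UltraBound ω f v := by
  intro l hl
  obtain ⟨C, hC, hb⟩ := hf l hl
  refine ⟨C * D, by positivity, fun i j k x => (hb i j k x).trans ?_⟩
  have := weightSeq_pos ω l k
  calc _ ≤ C * weightSeq ω l k * (D * v i x) := by gcongr; exact h i x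
    _ = _ := by ring

lemma integrable_iterate (hf : UltraBound ω f w) (hfs : ∀ i, ContDiff ℝ ∞ (f i))
    (hw : ∀ i, Integrable (w i)) (i : ι) (j : Fin d) (k : ℕ) :
    Integrable ((partialDeriv j)^[k] (f i)) := by
  obtain ⟨C, hC, hb⟩ := hf 1 one_pos
  exact ((hw i).const_mul _).mono'
    (contDiff_partialDeriv_iterate (hfs i) j k).continuous.aestronglyMeasurable
    (Filter.Eventually.of_forall (hb i j k))

end UltraBound

/-! ### Fourier decay versus ultradifferentiability -/

section Fourier

lemma norm_exp_neg_I_mul (r : ℝ) : ‖Complex.exp (-(Complex.I * (r : ℂ)))‖ = 1 := by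
  rw [← mul_neg, ← Complex.ofReal_neg, mul_comm]
  exact Complex.norm_exp_ofReal_mul_I _

lemma norm_fourierHat_le (f : E d → ℂ) (ξ : E d) : ‖fourierHat f ξ‖ ≤ ∫ x, ‖f x‖ := by
  refine (norm_integral_le_integral_norm _).trans_eq ?_
  simp only [norm_mul, norm_exp_neg_I_mul, one_mul]

lemma fourierHat_eq_fourier (f : E d → ℂ) (ξ : E d) :
    fourierHat f ((2 * Real.pi) • ξ) = 𝓕 f ξ := by
  rw [Real.fourier_eq', fourierHat]
  congr 1; ext x
  rw [inner_smul_right, smul_eq_mul]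
  push_cast
  ring_nf

lemma fourierHat_partialDeriv {f : E d → ℂ} (hf : ContDiff ℝ ∞ f) (j : Fin d)
    (hi : Integrable f) (hi' : Integrable (partialDeriv j f)) (ξ : E d) :
    fourierHat (partialDeriv j f) ξ = Complex.I * ξ j * fourierHat f ξ := by
  have hd : Differentiable ℝ f := hf.differentiable (by simp)
  have he : ∀ x : E d, HasFDerivAt (fun x : E d => Complex.exp (-(Complex.I * (inner ℝ x ξ : ℝ))))
      (Complex.exp (-(Complex.I * (inner ℝ x ξ : ℝ))) •
        (-(Complex.I • Complex.ofRealCLM.comp (innerSL ℝ ξ)))) x := by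
    intro x
    have h1 : HasFDerivAt (fun x : E d => ((inner ℝ x ξ : ℝ) : ℂ))
        (Complex.ofRealCLM.comp (innerSL ℝ ξ)) x := by
      have := (Complex.ofRealCLM.comp (innerSL ℝ ξ)).hasFDerivAt (x := x)
      refine this.congr_of_eventuallyEq (Filter.Eventually.of_forall fun y => ?_)
      simp [real_inner_comm]
    exact ((h1.const_mul Complex.I).neg).cexp
  have hb : ∀ {g : E d → ℂ}, Integrable g →
      Integrable fun x => Complex.exp (-(Complex.I * (inner ℝ x ξ : ℝ))) * g x := by
    intro g hg
    refine hg.bdd_mul (c := 1) ?_ (Filter.Eventually.of_forall fun x => (norm_exp_neg_I_mul _).le)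
    exact Continuous.aestronglyMeasurable (by fun_prop)
  rw [partialDeriv_eq_fderiv hd] at hi' ⊢
  have hfd : ∀ x : E d, fderiv ℝ (fun x : E d => Complex.exp (-(Complex.I * (inner ℝ x ξ : ℝ)))) x
      (EuclideanSpace.single j 1) * f x =
        -(Complex.I * ξ j) * (Complex.exp (-(Complex.I * (inner ℝ x ξ : ℝ))) * f x) := by
    intro x
    rw [(he x).fderiv]
    simp [EuclideanSpace.inner_single_right]
    ring
  rw [fourierHat, integral_mul_fderiv_eq_neg_fderiv_mul_of_integrable ?_ (hb hi') (hb hi)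
    (fun x _ => (he x).differentiableAt) (fun x _ => hd x)]
  · simp_rw [hfd]
    rw [integral_const_mul, fourierHat]
    ring
  · simp_rw [hfd]
    exact (hb hi).const_mul _

lemma fourierHat_partialDeriv_iterate {f : E d → ℂ} (hf : ContDiff ℝ ∞ f) (j : Fin d)
    (hi : ∀ k, Integrable ((partialDeriv j)^[k] f)) (k : ℕ) (ξ : E d) :
    fourierHat ((partialDeriv j)^[k] f) ξ = (Complex.I * ξ j) ^ k * fourierHat f ξ := by
  induction k with
  | zero => simp
  | succ k ih =>
    have := hi (k + 1)
    rw [Function.iterate_succ_apply'] at this ⊢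
    rw [fourierHat_partialDeriv (contDiff_partialDeriv_iterate hf j k) j (hi k) this, ih, pow_succ']
    ring

/-- The constant is `d` rather than `√d` so that it is an integer and subadditivity applies
directly. -/
lemma exists_norm_le_card_mul [NeZero d] (x : E d) : ∃ j, ‖x‖ ≤ d * |x j| := by
  obtain ⟨j, hj⟩ := Finite.exists_max fun j => |x j|
  refine ⟨j, abs_le_of_sq_le_sq' ?_ (by positivity) |>.2⟩
  have hd : (1 : ℝ) ≤ d := by exact_mod_cast NeZero.one_le
  calc ‖x‖ ^ 2 = ∑ i, |x i| ^ 2 := by simp [EuclideanSpace.norm_sq_eq]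
    _ ≤ ∑ _i : Fin d, |x j| ^ 2 := by
          exact Finset.sum_le_sum fun i _ => pow_le_pow_left₀ (abs_nonneg _) (hj i) 2
    _ = d * |x j| ^ 2 := by simp
    _ ≤ (d * |x j|) ^ 2 := by rw [mul_pow]; gcongr; nlinarith

variable {ω : ℝ → ℝ} {ι : Type*}

/-- The Fourier transforms of a uniformly ultradifferentiable family of integrable functions decay
rapidly. -/
lemma UltraBound.fourierHat_le [NeZero d] (hω : IsWeightFunction ω) {f : ι → E d → ℂ}
    {w : ι → E d → ℝ} (hf : UltraBound ω f w) (hfs : ∀ i, ContDiff ℝ ∞ (f i))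
    (hw : ∀ i, Integrable (w i)) (hw0 : ∀ i x, 0 ≤ w i x) {l : ℝ} (hl : 0 < l) :
    ∃ C : ℝ, 0 ≤ C ∧ ∀ i t,
      ‖fourierHat (f i) t‖ ≤ C * (∫ x, w i x) * Real.exp (-l * ω ‖t‖) := by
  -- The factor `d` pays for `ω(|t|) ≤ d ω(|t_j|)`. Below, `L + 1` replaces `L` to absorb the factor
  -- `|t_j|` lost in `le_exp_of_pow_mul_le`.
  set L := d * l with hL
  have hd : (0 : ℝ) < d := by exact_mod_cast NeZero.pos d
  have hL0 : 0 < L := by positivity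
  obtain ⟨A, hA, hb⟩ := hf (L + 1) (by positivity)
  obtain ⟨B, hB, hB'⟩ := hω.exists_one_add_pow_le 1 one_pos
  set D := A * B + A * weightSeq ω (L + 1) 0 * Real.exp (L * ω 1) with hD
  have hM0 := weightSeq_pos ω (L + 1) 0
  refine ⟨D, by positivity, fun i t => ?_⟩
  have hW : 0 ≤ ∫ x, w i x := integral_nonneg (hw0 i)
  obtain ⟨j, hj⟩ := exists_norm_le_card_mul t
  have hk : ∀ k : ℕ, |t j| ^ k * ‖fourierHat (f i) t‖ ≤
      A * (∫ x, w i x) * weightSeq ω (L + 1) k := by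
    intro k
    have h1 := fourierHat_partialDeriv_iterate (hfs i) j
      (fun k => hf.integrable_iterate hfs hw i j k) k t
    have h2 := norm_fourierHat_le ((partialDeriv j)^[k] (f i)) t
    rw [h1] at h2
    simp only [norm_mul, norm_pow, Complex.norm_I, one_mul, Complex.norm_real,
      Real.norm_eq_abs] at h2
    refine h2.trans ?_
    refine (integral_mono (hf.integrable_iterate hfs hw i j k).norm
      ((hw i).const_mul _) (hb i j k)).trans_eq ?_
    rw [integral_const_mul]
    ring
  have hωt : ω ‖t‖ ≤ d * ω |t j| := by
    have h := hω.natCast_mul_le (d - 1) (abs_nonneg (t j))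
    rw [Nat.sub_add_cancel NeZero.one_le] at h
    exact (hω.mono (norm_nonneg _) hj).trans h
  have h0 := hω.nonneg |t j| (abs_nonneg _)
  have main : ‖fourierHat (f i) t‖ ≤ D * (∫ x, w i x) * Real.exp (-L * ω |t j|) := by
    rcases le_total 1 |t j| with h | h
    · have h3 := hω.le_exp_of_pow_mul_le (by positivity) h (by positivity) hk
      have h4 : |t j| ≤ B * Real.exp (1 * ω |t j|) :=
        (hB' _ (abs_nonneg _)).trans' (by linarith)
      calc _ ≤ A * (∫ x, w i x) * (B * Real.exp (1 * ω |t j|)) *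
            Real.exp (-(L + 1) * ω |t j|) := h3.trans (by gcongr)
        _ = A * B * (∫ x, w i x) * (Real.exp (1 * ω |t j|) * Real.exp (-(L + 1) * ω |t j|)) := by
            ring
        _ = A * B * (∫ x, w i x) * Real.exp (-L * ω |t j|) := by
            rw [← Real.exp_add]; ring_nf
        _ ≤ _ := by
            gcongr
            exact le_add_of_nonneg_right (by positivity)
    · have h3 := hk 0
      rw [pow_zero, one_mul] at h3
      have h4 : 1 ≤ Real.exp (L * ω 1) * Real.exp (-L * ω |t j|) := by
        rw [← Real.exp_add]
        refine Real.one_le_exp ?_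
        have := hω.mono (abs_nonneg _) h
        nlinarith
      calc _ ≤ A * (∫ x, w i x) * weightSeq ω (L + 1) 0 * 1 := by simpa using h3
        _ ≤ A * (∫ x, w i x) * weightSeq ω (L + 1) 0 *
            (Real.exp (L * ω 1) * Real.exp (-L * ω |t j|)) := by gcongr
        _ = A * weightSeq ω (L + 1) 0 * Real.exp (L * ω 1) * (∫ x, w i x) *
            Real.exp (-L * ω |t j|) := by ring
        _ ≤ _ := by
            gcongr
            exact le_add_of_nonneg_left (by positivity)
  refine main.trans ?_
  gcongr ?_ * Real.exp ?_
  nlinarith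

lemma norm_le_integral_fourier {f : E d → ℂ} (hc : Continuous f) (hi : Integrable f)
    (hi' : Integrable (𝓕 f)) (x : E d) : ‖f x‖ ≤ ∫ ξ, ‖𝓕 f ξ‖ := by
  conv_lhs => rw [← hc.fourierInv_fourier_eq hi hi']
  rw [Real.fourierInv_eq]
  refine (norm_integral_le_integral_norm _).trans_eq ?_
  simp

/-- Rapid decay of the Fourier transforms implies uniform ultradifferentiability. -/
lemma ultraBound_of_fourierHat_le (hω : IsWeightFunction ω) {f : ι → E d → ℂ} {c : ι → ℝ}
    (hfs : ∀ i, ContDiff ℝ ∞ (f i)) (hi : ∀ i j k, Integrable ((partialDeriv j)^[k] (f i)))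
    (hc : ∀ i, 0 ≤ c i)
    (h : ∀ l : ℝ, 0 < l → ∃ C : ℝ, 0 ≤ C ∧ ∀ i t,
      ‖fourierHat (f i) t‖ ≤ C * c i * Real.exp (-l * ω ‖t‖)) :
    UltraBound ω f (fun i _ => c i) := by
  intro l hl
  -- `l` is spent on the power `|t_j|^k`, the extra unit makes the transform integrable for Fourier
  -- inversion.
  obtain ⟨C, hC, hb⟩ := h (l + 1) (by positivity)
  have hint := hω.integrable_exp_neg (d := d) one_pos
  set J := ∫ x : E d, Real.exp (-1 * ω ‖x‖) with hJ
  have hJ0 : 0 ≤ J := integral_nonneg fun x => (Real.exp_pos _).le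
  refine ⟨C * Real.exp (l * ω 1) * J, by positivity, fun i j k x => ?_⟩
  set F := (partialDeriv j)^[k] (f i) with hF
  have hFb : ∀ ξ, ‖𝓕 F ξ‖ ≤
      C * c i * (Real.exp (l * ω 1) * weightSeq ω l k) * Real.exp (-1 * ω ‖ξ‖) := by
    intro ξ
    have hpi : (1 : ℝ) ≤ 2 * Real.pi := by linarith [Real.pi_gt_three]
    set t := (2 * Real.pi) • ξ with ht
    have h1 : ω ‖ξ‖ ≤ ω ‖t‖ := by
      refine hω.mono (norm_nonneg _) ?_
      rw [ht, norm_smul, Real.norm_of_nonneg (by positivity)]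
      exact le_mul_of_one_le_left (norm_nonneg _) hpi
    rw [← fourierHat_eq_fourier, ← ht, fourierHat_partialDeriv_iterate (hfs i) j (hi i j)]
    simp only [norm_mul, norm_pow, Complex.norm_I, one_mul, Complex.norm_real]
    have h2 : ‖t j‖ ≤ ‖t‖ := PiLp.norm_apply_le t j
    have h3 := hω.pow_mul_exp_le hl k (norm_nonneg _) h2
    have hci := hc i
    calc ‖t j‖ ^ k * ‖fourierHat (f i) t‖
        ≤ ‖t j‖ ^ k * (C * c i * Real.exp (-(l + 1) * ω ‖t‖)) := by gcongr; exact hb i t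
      _ = C * c i * (‖t j‖ ^ k * Real.exp (-l * ω ‖t‖)) * Real.exp (-1 * ω ‖t‖) := by
          rw [show -(l + 1) * ω ‖t‖ = -l * ω ‖t‖ + -1 * ω ‖t‖ by ring, Real.exp_add]; ring
      _ ≤ C * c i * (Real.exp (l * ω 1) * weightSeq ω l k) * Real.exp (-1 * ω ‖ξ‖) := by
          have := weightSeq_pos ω l k
          gcongr ?_ * ?_ * Real.exp ?_
          linarith
  have hcont : Continuous (𝓕 F) :=
    VectorFourier.fourierIntegral_continuous Real.continuous_fourierChar
      (by exact continuous_inner) (hi i j k)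
  have hFi : Integrable (𝓕 F) :=
    (hint.const_mul _).mono' hcont.aestronglyMeasurable (Filter.Eventually.of_forall hFb)
  refine (norm_le_integral_fourier (contDiff_partialDeriv_iterate (hfs i) j k).continuous
    (hi i j k) hFi x).trans ?_
  refine (integral_mono hFi.norm (hint.const_mul _) hFb).trans_eq ?_
  rw [integral_const_mul]
  ring

end Fourier

end

section

variable {d : ℕ}

/-! ### Gaussians and their ultradifferentiable bounds -/

section Gaussian

lemma iteratedDeriv_comp_ofReal {h : ℂ → ℂ} (hh : ContDiff ℂ ∞ h) (k : ℕ) :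
    iteratedDeriv k (fun s : ℝ => h s) = fun s : ℝ => iteratedDeriv k h s := by
  induction k with
  | zero => simp
  | succ k ih =>
    rw [iteratedDeriv_succ, ih, iteratedDeriv_succ]
    funext s
    exact ((hh.differentiable_iteratedDeriv k (by exact_mod_cast ENat.natCast_lt_top k))
      (s : ℂ)).hasDerivAt.comp_ofReal.deriv

/-- The Gaussian `x ↦ exp (σ |x - θ|² / 2)`. -/
def gaussian (σ : ℝ) (θ x : E d) : ℂ := ((Real.exp (σ * ‖x - θ‖ ^ 2 / 2) : ℝ) : ℂ)

lemma contDiff_gaussian (σ : ℝ) (θ : E d) : ContDiff ℝ ∞ (gaussian σ θ) :=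
  Complex.ofRealCLM.contDiff.comp (Real.contDiff_exp.comp
    ((contDiff_const.mul ((contDiff_id.sub contDiff_const).norm_sq ℝ)).div_const 2))

variable {ω : ℝ → ℝ}

lemma ultraBound_gaussian (hω : IsWeightFunction ω) {σ : ℝ} (hσ : |σ| ≤ 1) :
    UltraBound ω (gaussian (d := d) σ)
      (fun θ x => Real.exp ((σ / 2 + 1 / 4) * ‖x - θ‖ ^ 2)) := by
  intro l hl
  obtain ⟨C, r, hC, hr, hfac⟩ := hω.exists_factorial_le hl
  -- On the circle `|z| = r` the exponent exceeds `σ‖u‖²/2` by at most `r‖u‖ + r²/2`, and `r‖u‖ ≤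
  -- ‖u‖²/4 + r²`.
  refine ⟨C * Real.exp (3 * r ^ 2 / 2), by positivity, fun θ j k x => ?_⟩
  set u := x - θ with hu
  set h : ℂ → ℂ := fun z => Complex.exp (σ * (‖u‖ ^ 2 + 2 * z * u j + z ^ 2) / 2) with hh
  have hcd : ContDiff ℂ ∞ h := by simp only [hh]; fun_prop
  have hline : (fun s : ℝ => gaussian σ θ (x + s • EuclideanSpace.single j 1)) =
      fun s : ℝ => h s := by
    funext s
    have : ‖x + s • EuclideanSpace.single j (1 : ℝ) - θ‖ ^ 2 = ‖u‖ ^ 2 + 2 * s * u j + s ^ 2 := by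
      rw [add_sub_right_comm, ← hu, norm_add_sq_real, inner_smul_right, norm_smul,
        EuclideanSpace.inner_single_right]
      simp
      ring
    simp only [gaussian, hh, this]
    push_cast
    rfl
  have hsphere : ∀ z ∈ Metric.sphere (0 : ℂ) r,
      ‖h z‖ ≤ Real.exp (3 * r ^ 2 / 2) * Real.exp ((σ / 2 + 1 / 4) * ‖u‖ ^ 2) := by
    intro z hz
    have hzr : ‖z‖ = r := by simpa using hz
    have huj : |u j| ≤ ‖u‖ := PiLp.norm_apply_le u j
    have hre : |(2 * z * u j + z ^ 2).re| ≤ 2 * r * ‖u‖ + r ^ 2 := by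
      refine (Complex.abs_re_le_norm _).trans ((norm_add_le _ _).trans ?_)
      simp only [norm_mul, norm_pow, hzr, Complex.norm_real, Real.norm_eq_abs, Complex.norm_two]
      gcongr
    have hσre : σ * (2 * z * u j + z ^ 2).re ≤ 2 * r * ‖u‖ + r ^ 2 := by
      refine (le_abs_self _).trans ?_
      rw [abs_mul]
      calc |σ| * |(2 * z * u j + z ^ 2).re| ≤ 1 * (2 * r * ‖u‖ + r ^ 2) := by gcongr
        _ = _ := one_mul _
    rw [hh, Complex.norm_exp, ← Real.exp_add]
    refine Real.exp_le_exp.2 ?_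
    have e : (σ * (‖u‖ ^ 2 + 2 * z * u j + z ^ 2) / 2 : ℂ) =
        ((σ / 2 : ℝ) : ℂ) * (((‖u‖ ^ 2 : ℝ) : ℂ) + (2 * z * u j + z ^ 2)) := by push_cast; ring
    rw [e, Complex.re_ofReal_mul, Complex.add_re, Complex.ofReal_re]
    nlinarith [sq_nonneg (‖u‖ - 2 * r)]
  rw [partialDeriv_iterate_eq, hline, iteratedDeriv_comp_ofReal hcd]
  -- Cauchy's estimate on the circle whose radius is the `r` of the factorial bound, so that `r^k`
  -- cancels.
  refine (Complex.norm_iteratedDeriv_le_of_forall_mem_sphere_norm_le k hr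
    (hcd.differentiable (by simp)).diffContOnCl (by rw [Complex.ofReal_zero]; exact hsphere)).trans ?_
  rw [div_le_iff₀ (by positivity)]
  calc _ ≤ C * r ^ k * weightSeq ω l k *
        (Real.exp (3 * r ^ 2 / 2) * Real.exp ((σ / 2 + 1 / 4) * ‖u‖ ^ 2)) :=
        mul_le_mul_of_nonneg_right (hfac k) (mul_pos (Real.exp_pos _) (Real.exp_pos _)).le
    _ = _ := by ring

lemma IsWeightFunction.mul_le_sq (hω : IsWeightFunction ω) {l : ℝ} (hl : 0 ≤ l) {t : ℝ}
    (ht : 0 ≤ t) : l * ω t ≤ 1 / 4 * t ^ 2 + ((l * ω 1) ^ 2 + l * ω 1) := by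
  have h := mul_le_mul_of_nonneg_left (hω.le_linear ht) hl
  nlinarith [sq_nonneg (t / 2 - l * ω 1)]

lemma IsWeightFunction.integrable_exp_neg_sq (hω : IsWeightFunction ω) (θ : E d) :
    Integrable fun x : E d => Real.exp ((-1 / 2 + 1 / 4) * ‖x - θ‖ ^ 2) := by
  suffices h : Integrable fun x : E d => Real.exp ((-1 / 2 + 1 / 4) * ‖x‖ ^ 2) from h.comp_sub_right θ
  refine ((hω.integrable_exp_neg one_pos).const_mul
    (Real.exp ((1 * ω 1) ^ 2 + 1 * ω 1))).mono'
    (Continuous.aestronglyMeasurable (by fun_prop)) (Filter.Eventually.of_forall fun x => ?_)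
  rw [Real.norm_of_nonneg (Real.exp_pos _).le, ← Real.exp_add]
  have := hω.mul_le_sq zero_le_one (norm_nonneg x)
  exact Real.exp_le_exp.2 (by linarith)

end Gaussian

/-- The smaller of two exponents is at most their mean; this combines decay in different variables.
-/
lemma le_exp_half_add {F A B p q : ℝ} (hA : 0 ≤ A) (hB : 0 ≤ B) (h1 : F ≤ A * Real.exp p)
    (h2 : F ≤ B * Real.exp q) : F ≤ (A + B) * Real.exp ((p + q) / 2) := by
  have hp := Real.exp_pos ((p + q) / 2)
  rcases le_total p q with h | h
  · calc F ≤ A * Real.exp ((p + q) / 2) := h1.trans (by gcongr; linarith)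
      _ ≤ _ := by nlinarith
  · calc F ≤ B * Real.exp ((p + q) / 2) := h2.trans (by gcongr; linarith)
      _ ≤ _ := by nlinarith

/-! ### Ultradifferentiable decay from rapid decay -/

lemma exists_schwartz_partialDeriv_iterate (g : 𝓢(E d, ℂ)) (j : Fin d) (k : ℕ) :
    ∃ g' : 𝓢(E d, ℂ), (partialDeriv j)^[k] g = g' := by
  induction k with
  | zero => exact ⟨g, rfl⟩
  | succ k ih =>
    obtain ⟨g', hg'⟩ := ih
    refine ⟨LineDeriv.lineDerivOp (EuclideanSpace.single j (1 : ℝ)) g', ?_⟩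
    rw [Function.iterate_succ_apply', hg']
    funext x
    exact (SchwartzMap.lineDerivOp_apply _ g' x).symm

variable {ω : ℝ → ℝ}

/-- Rapid decay of order `ω`. -/
def RapidDecay (ω : ℝ → ℝ) (f : E d → ℂ) : Prop :=
  ∀ l : ℝ, 0 < l → ∃ C : ℝ, 0 ≤ C ∧ ∀ x, ‖f x‖ ≤ C * Real.exp (-l * ω ‖x‖)

/-- A Schwartz function which decays rapidly together with its Fourier transform has rapidly
decaying derivatives with ultradifferentiable bounds. -/
lemma ultraBound_of_rapidDecay [NeZero d] (hω : IsWeightFunction ω) (g : 𝓢(E d, ℂ))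
    (hg : RapidDecay ω g) (hg' : RapidDecay ω (fourierHat g)) {L : ℝ} (hL : 0 < L) :
    UltraBound ω (fun _ : Unit => (g : E d → ℂ)) (fun _ x => Real.exp (-L * ω ‖x‖)) := by
  have hgs : ContDiff ℝ ∞ g := g.smooth'
  have hgi : ∀ j k, Integrable ((partialDeriv j)^[k] g) := fun j k => by
    obtain ⟨g', h⟩ := exists_schwartz_partialDeriv_iterate g j k
    rw [h]; exact g'.integrable
  -- Fourier inversion bounds the derivatives, as yet without decay in `x`.
  have h1 : UltraBound ω (fun _ : E d => (g : E d → ℂ)) (fun _ _ => 1) := by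
    refine ultraBound_of_fourierHat_le hω (fun _ => hgs) (fun _ => hgi) (fun _ => zero_le_one)
      fun l hl => ?_
    obtain ⟨C, hC, h⟩ := hg' l hl
    exact ⟨C, hC, fun _ t => by simpa using h t⟩
  set f : E d → E d → ℂ := fun θ x => gaussian (-1) θ x * g x with hf
  have hfs : ∀ θ, ContDiff ℝ ∞ (f θ) := fun θ => (contDiff_gaussian _ θ).mul hgs
  have h2 : UltraBound ω f
      (fun θ x => Real.exp ((-1 / 2 + 1 / 4) * ‖x - θ‖ ^ 2) * 1) :=
    (ultraBound_gaussian hω (by norm_num)).mul hω h1 (fun θ => contDiff_gaussian _ θ) fun _ => hgs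
  have hw : ∀ θ : E d, Integrable
      fun x : E d => Real.exp ((-1 / 2 + 1 / 4) * ‖x - θ‖ ^ 2) * 1 :=
    fun θ => (hω.integrable_exp_neg_sq θ).mul_const 1
  set J := ∫ x : E d, Real.exp ((-1 / 2 + 1 / 4) * ‖x‖ ^ 2) with hJ
  have hJ0 : 0 ≤ J := integral_nonneg fun x => (Real.exp_pos _).le
  have hJθ : ∀ θ : E d, ∫ x : E d, Real.exp ((-1 / 2 + 1 / 4) * ‖x - θ‖ ^ 2) = J := fun θ =>
    integral_sub_right_eq_self (fun x : E d => Real.exp ((-1 / 2 + 1 / 4) * ‖x‖ ^ 2)) θ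
  obtain ⟨B, hB, hgB⟩ := hg (2 * L) (by positivity)
  set Q := Real.exp ((2 * L * ω 1) ^ 2 + 2 * L * ω 1) with hQ
  -- Decay in the centre `θ`: the Gaussian keeps `x` near `θ`, where `g` is small. The price
  -- `2Lω(x-θ)` is at most `|x-θ|²/4` plus a constant.
  have h3 : ∀ θ t, ‖fourierHat (f θ) t‖ ≤ B * Q * J * Real.exp (-(2 * L) * ω ‖θ‖) := by
    intro θ t
    have hpt : ∀ x, ‖f θ x‖ ≤ B * Q * Real.exp (-(2 * L) * ω ‖θ‖) *
        Real.exp ((-1 / 2 + 1 / 4) * ‖x - θ‖ ^ 2) := by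
      intro x
      have e1 := hω.mul_le_sq (l := 2 * L) (by positivity) (norm_nonneg (x - θ))
      have e2 := hω.norm_le_add_sub θ x
      rw [norm_sub_rev] at e2
      calc ‖f θ x‖ = Real.exp (-1 * ‖x - θ‖ ^ 2 / 2) * ‖g x‖ := by
            rw [hf, norm_mul, gaussian, Complex.norm_real, Real.norm_of_nonneg (Real.exp_pos _).le]
        _ ≤ Real.exp (-1 * ‖x - θ‖ ^ 2 / 2) * (B * Real.exp (-(2 * L) * ω ‖x‖)) := by
            gcongr; exact hgB x
        _ = B * Real.exp (-1 * ‖x - θ‖ ^ 2 / 2 + -(2 * L) * ω ‖x‖) := by rw [Real.exp_add]; ring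
        _ ≤ B * Real.exp (((2 * L * ω 1) ^ 2 + 2 * L * ω 1) + -(2 * L) * ω ‖θ‖ +
            (-1 / 2 + 1 / 4) * ‖x - θ‖ ^ 2) := by
            refine mul_le_mul_of_nonneg_left (Real.exp_le_exp.2 ?_) hB
            nlinarith
        _ = _ := by rw [Real.exp_add, Real.exp_add]; ring
    refine (norm_fourierHat_le _ _).trans ?_
    refine (integral_mono_of_nonneg (Filter.Eventually.of_forall fun _ => norm_nonneg _)
      ((hω.integrable_exp_neg_sq θ).const_mul _) (Filter.Eventually.of_forall hpt)).trans_eq ?_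
    rw [integral_const_mul, hJθ]
    ring
  -- The geometric mean of the decay in `t` and in `θ` has both; inversion turns the former into
  -- derivative bounds.
  have h4 : UltraBound ω f (fun θ _ => Real.exp (-L * ω ‖θ‖)) := by
    refine ultraBound_of_fourierHat_le hω hfs
      (fun θ j k => h2.integrable_iterate hfs hw θ j k) (fun _ => (Real.exp_pos _).le)
      fun l hl => ?_
    obtain ⟨A, hA, hAb⟩ := h2.fourierHat_le hω hfs hw (fun _ _ => by positivity)
      (l := 2 * l) (by positivity)
    refine ⟨A * J + B * Q * J, by positivity, fun θ t => ?_⟩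
    have hA' := hAb θ t
    simp only [mul_one, hJθ] at hA'
    refine (le_exp_half_add (by positivity) (by positivity) hA' (h3 θ t)).trans_eq ?_
    rw [mul_assoc _ (Real.exp _) (Real.exp _), ← Real.exp_add]
    congr 2
    ring
  have h5 := h4.mul hω (ultraBound_gaussian hω (σ := 1) (by norm_num)) hfs
    fun θ => contDiff_gaussian _ θ
  have hfg : ∀ θ : E d, (fun x => f θ x * gaussian 1 θ x) = g := by
    intro θ
    funext x
    have : gaussian (-1) θ x * gaussian 1 θ x = 1 := by
      simp only [gaussian, ← Complex.ofReal_mul, ← Real.exp_add]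
      ring_nf
      simp
    rw [hf]
    simp only
    rw [mul_right_comm, this, one_mul]
  intro l hl
  obtain ⟨C, hC, h⟩ := h5 l hl
  refine ⟨C, hC, fun _ j k x => ?_⟩
  -- Taking the centre `θ = x` makes the weight of the inverse Gaussian equal to `1`.
  have := h x j k x
  simp only [hfg] at this
  simpa using this

lemma IsWeightFunction.mul_norm_le (hω : IsWeightFunction ω) (m : ℝ) {F : Type*}
    [SeminormedAddCommGroup F] (x y : F) : m * ω ‖x‖ ≤ m * ω ‖y‖ + |m| * ω ‖x - y‖ := by
  have h1 := hω.norm_le_add_sub x y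
  have h2 := hω.norm_le_add_sub y x
  rw [norm_sub_rev] at h2
  rcases le_total 0 m with h | h
  · rw [abs_of_nonneg h]; nlinarith
  · rw [abs_of_nonpos h]; nlinarith

/-- Fourier decay of the product of a family of symbols with translates of a rapidly decaying
window. -/
lemma exists_fourierHat_mul_le [NeZero d] (hω : IsWeightFunction ω) {ι : Type*} {m : ℝ}
    {b : ι → E d → ℂ} {c : ι → ℝ} {g : E d → ℂ} (τ : ι → E d) (hc : ∀ i, 0 ≤ c i)
    (hbs : ∀ i, ContDiff ℝ ∞ (b i))
    (hb : UltraBound ω b (fun i x => c i * Real.exp (m * ω ‖x‖))) (hgs : ContDiff ℝ ∞ g)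
    (hg : ∀ L : ℝ, 0 < L →
      UltraBound ω (fun _ : Unit => g) (fun _ x => Real.exp (-L * ω ‖x‖))) {l : ℝ} (hl : 0 < l) :
    ∃ C : ℝ, 0 ≤ C ∧ ∀ i t, ‖fourierHat (fun x => b i x * g (x - τ i)) t‖ ≤
      C * (c i * Real.exp (m * ω ‖τ i‖)) * Real.exp (-l * ω ‖t‖) := by
  have hgs' : ∀ i, ContDiff ℝ ∞ (fun x => g (x - τ i)) := fun i =>
    hgs.comp (contDiff_id.sub contDiff_const)
  -- In the exponent, `|m|` pays for replacing `mω(x)` by `mω(τ i)`; the remaining unit keeps the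
  -- weight integrable.
  have h1 : UltraBound ω (fun i x => g (x - τ i))
      (fun i x => Real.exp (-(|m| + 1) * ω ‖x - τ i‖)) := by
    intro l hl
    obtain ⟨C, hC, h⟩ := hg (|m| + 1) (by positivity) l hl
    refine ⟨C, hC, fun i j k x => ?_⟩
    rw [partialDeriv_iterate_comp_sub]
    exact h () j k (x - τ i)
  have h2 := (hb.mul hω h1 hbs hgs').mono (D := 1)
    (v := fun i x => c i * Real.exp (m * ω ‖τ i‖) * Real.exp (-1 * ω ‖x - τ i‖)) zero_le_one
    (fun i x => by
      have := hω.mul_norm_le m x (τ i)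
      have hci := hc i
      rw [one_mul, mul_assoc, mul_assoc, ← Real.exp_add, ← Real.exp_add]
      refine mul_le_mul_of_nonneg_left (Real.exp_le_exp.2 ?_) hci
      linarith)
  have hint := hω.integrable_exp_neg (d := d) one_pos
  obtain ⟨C, hC, h⟩ := h2.fourierHat_le hω (fun i => (hbs i).mul (hgs' i))
    (fun i => (hint.comp_sub_right (τ i)).const_mul _)
    (fun i x => by have := hc i; positivity) hl
  refine ⟨C * ∫ x : E d, Real.exp (-1 * ω ‖x‖),
    mul_nonneg hC (integral_nonneg fun _ => (Real.exp_pos _).le), fun i t => (h i t).trans_eq ?_⟩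
  rw [integral_const_mul,
    integral_sub_right_eq_self (fun x : E d => Real.exp (-1 * ω ‖x‖)) (τ i)]
  ring

end

section

variable {d : ℕ} {ω : ℝ → ℝ}

/-! ### The window and its Fourier transform -/

section Window

lemma fourierHat_eq_fourier_inv_smul (f : E d → ℂ) (ξ : E d) :
    fourierHat f ξ = 𝓕 f ((2 * Real.pi)⁻¹ • ξ) := by
  rw [← fourierHat_eq_fourier, smul_smul, mul_inv_cancel₀ (by positivity), one_smul]

lemma exists_schwartz_fourierHat (φ : 𝓢(E d, ℂ)) : ∃ ψ : 𝓢(E d, ℂ), ⇑ψ = fourierHat φ := by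
  refine ⟨SchwartzMap.compCLMOfContinuousLinearEquiv ℂ
    (ContinuousLinearEquiv.smulLeft (M₁ := E d) (R₁ := ℝ)
      (Units.mk0 ((2 * Real.pi)⁻¹ : ℝ) (by positivity))) (𝓕 φ), ?_⟩
  funext ξ
  rw [fourierHat_eq_fourier_inv_smul, SchwartzMap.compCLMOfContinuousLinearEquiv_apply,
    Function.comp_apply, SchwartzMap.fourier_coe]
  rfl

/-- Inversion shows that `φ̂` also satisfies the hypotheses of `ultraBound_of_rapidDecay`. -/
lemma fourierHat_fourierHat (φ : 𝓢(E d, ℂ)) (x : E d) :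
    fourierHat (fourierHat φ) x = ((2 * Real.pi) ^ d : ℝ) * φ (-x) := by
  let F : E d → ℂ := fun η =>
    Complex.exp (-(Complex.I * (inner ℝ ((2 * Real.pi) • η) x : ℝ))) * 𝓕 (φ : E d → ℂ) η
  have h1 : fourierHat (fourierHat φ) x = ∫ ξ : E d, F ((2 * Real.pi)⁻¹ • ξ) := by
    rw [fourierHat]
    congr 1
    ext ξ
    simp only [F]
    rw [fourierHat_eq_fourier_inv_smul, smul_smul, mul_inv_cancel₀ (by positivity), one_smul]
  have hpi : 0 ≤ 2 * Real.pi := by positivity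
  rw [h1, Measure.integral_comp_inv_smul_of_nonneg volume F hpi, finrank_euclideanSpace,
    Fintype.card_fin]
  have h2 : 𝓕⁻ (𝓕 (φ : E d → ℂ)) (-x) = φ (-x) := by
    have hi : Integrable (𝓕 (φ : E d → ℂ)) := by
      rw [← SchwartzMap.fourier_coe]; exact (𝓕 φ).integrable
    rw [φ.continuous.fourierInv_fourier_eq φ.integrable hi]
  rw [← h2, Real.fourierInv_eq', Complex.real_smul]
  congr 2
  ext η
  simp only [F]
  rw [real_inner_smul_left, inner_neg_right, smul_eq_mul]
  push_cast
  ring_nf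

lemma rapidDecay_multiDeriv {φ : 𝓢(E d, ℂ)} (hφ : φ ∈ weightedSchwartz d ω) (α : Fin d → ℕ) :
    RapidDecay ω (multiDeriv α φ) ∧ RapidDecay ω (multiDeriv α (fourierHat φ)) := by
  have key : ∀ f : E d → ℂ, (∀ l : ℝ, 0 < l → ∃ C : ℝ, ∀ x : E d,
      Real.exp (l * ω ‖x‖) * ‖f x‖ ≤ C) → RapidDecay ω f := by
    intro f h l hl
    obtain ⟨C, hC⟩ := h l hl
    refine ⟨C, (hC 0).trans' (by positivity), fun x => ?_⟩
    rw [neg_mul, Real.exp_neg, ← div_eq_mul_inv, le_div_iff₀ (Real.exp_pos _), mul_comm]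
    exact hC x
  exact ⟨key _ fun l hl => hφ.1 l hl α, key _ fun l hl => hφ.2 l hl α⟩

lemma rapidDecay_of_mem {φ : 𝓢(E d, ℂ)} (hφ : φ ∈ weightedSchwartz d ω) :
    RapidDecay ω φ ∧ RapidDecay ω (fourierHat φ) := by
  simpa only [multiDeriv_zero] using rapidDecay_multiDeriv hφ 0

lemma ultraBound_conj_window [NeZero d] (hω : IsWeightFunction ω) {φ : 𝓢(E d, ℂ)}
    (hφ : φ ∈ weightedSchwartz d ω) {L : ℝ} (hL : 0 < L) :
    UltraBound ω (fun _ : Unit => fun x : E d => starRingEnd ℂ (φ x))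
      (fun _ x => Real.exp (-L * ω ‖x‖)) := by
  obtain ⟨h1, h2⟩ := rapidDecay_of_mem hφ
  intro l hl
  obtain ⟨C, hC, h⟩ := ultraBound_of_rapidDecay hω φ h1 h2 hL l hl
  refine ⟨C, hC, fun i j k x => ?_⟩
  rw [partialDeriv_iterate_conj, RCLike.norm_conj]
  exact h i j k x

lemma ultraBound_fourierHat_window [NeZero d] (hω : IsWeightFunction ω) {φ : 𝓢(E d, ℂ)}
    (hφ : φ ∈ weightedSchwartz d ω) {L : ℝ} (hL : 0 < L) :
    UltraBound ω (fun _ : Unit => fourierHat (φ : E d → ℂ))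
      (fun _ x => Real.exp (-L * ω ‖x‖)) := by
  obtain ⟨h1, h2⟩ := rapidDecay_of_mem hφ
  obtain ⟨ψ, hψ⟩ := exists_schwartz_fourierHat φ
  rw [← hψ]
  refine ultraBound_of_rapidDecay hω ψ (by rwa [hψ]) ?_ hL
  intro l hl
  obtain ⟨C, hC, h⟩ := h1 l hl
  refine ⟨(2 * Real.pi) ^ d * C, by positivity, fun x => ?_⟩
  rw [hψ, fourierHat_fourierHat, norm_mul, Complex.norm_real,
    Real.norm_of_nonneg (by positivity), mul_assoc]
  gcongr
  simpa using h (-x)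

lemma contDiff_fourierHat (φ : 𝓢(E d, ℂ)) : ContDiff ℝ ∞ (fourierHat (φ : E d → ℂ)) := by
  obtain ⟨ψ, hψ⟩ := exists_schwartz_fourierHat φ
  rw [← hψ]
  exact ψ.smooth'

lemma contDiff_conj {f : E d → ℂ} (hf : ContDiff ℝ ∞ f) :
    ContDiff ℝ ∞ fun x => starRingEnd ℂ (f x) :=
  Complex.conjCLE.contDiff.comp hf

end Window

/-! ### Symbols in one variable at a time -/

section Symbol

variable {m : ℝ} {a : E d × E d → ℂ}

lemma exists_symbol_norm_le (ha : a ∈ symbolClass d ω m) :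
    ∃ C : ℝ, 0 ≤ C ∧ ∀ p : E d × E d, ‖a p‖ ≤ C * Real.exp (m * ω ‖p.2‖) := by
  obtain ⟨C, hC, h⟩ := ha.2 1 1 one_pos one_pos
  refine ⟨C * Real.exp (1 * youngConj ω (0 / 1)) * Real.exp (1 * youngConj ω (0 / 1)),
    by positivity, fun p => ?_⟩
  have := h 0 0 p.1 p.2
  simpa only [mixedDeriv, multiDeriv_zero, multiLength_zero] using this

/-- The second slot of the index is reserved for the centre of the window. -/
lemma ultraBound_symbol_snd (ha : a ∈ symbolClass d ω m) :
    UltraBound ω (fun (i : E d × E d) ξ => a (i.1, ξ))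
      (fun _ ξ => 1 * Real.exp (m * ω ‖ξ‖)) := by
  intro l hl
  obtain ⟨C, hC, h⟩ := ha.2 1 l one_pos hl
  refine ⟨C * Real.exp (1 * youngConj ω (0 / 1)), by positivity, fun i j k ξ => ?_⟩
  have := h 0 (Pi.single j k) i.1 ξ
  simpa only [mixedDeriv, multiDeriv_zero, multiDeriv_single, multiLength_single,
    multiLength_zero, weightSeq, one_mul] using this

/-- In `x` the symbol has growth exponent `0`; the factor `e^{mω(ξ)}` is a constant of the family.
-/
lemma ultraBound_symbol_fst (ha : a ∈ symbolClass d ω m) :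
    UltraBound ω (fun (i : E d × E d) x => a (x, i.1))
      (fun i x => Real.exp (m * ω ‖i.1‖) * Real.exp (0 * ω ‖x‖)) := by
  intro l hl
  obtain ⟨C, hC, h⟩ := ha.2 l 1 hl one_pos
  refine ⟨C * Real.exp (1 * youngConj ω (0 / 1)), by positivity, fun i j k x => ?_⟩
  have := h (Pi.single j k) 0 x i.1
  simp only [mixedDeriv, multiDeriv_zero, multiDeriv_single, multiLength_single,
    multiLength_zero] at this
  refine this.trans_eq ?_
  simp only [weightSeq, zero_mul, Real.exp_zero]
  ring

end Symbol

/-! ### Kernel estimates -/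

section Kernel

variable {m : ℝ} {a : E d × E d → ℂ} {φ : 𝓢(E d, ℂ)}

lemma norm_kernelIntegrand (φ : E d → ℂ) (a : E d × E d → ℂ) (z' z p : E d × E d) :
    ‖kernelIntegrand φ a z' z p‖ =
      ‖a p‖ * ‖fourierHat φ (p.2 - z.2)‖ * ‖φ (p.1 - z'.1)‖ := by
  rw [kernelIntegrand, norm_mul, norm_mul, norm_mul, RCLike.norm_conj, mul_comm Complex.I,
    Complex.norm_exp_ofReal_mul_I, one_mul]

lemma exists_norm_kernelIntegrand_le (ha : a ∈ symbolClass d ω m)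
    (hφ : φ ∈ weightedSchwartz d ω) {L : ℝ} (hL : 0 < L) :
    ∃ C : ℝ, 0 ≤ C ∧ ∀ z' z p : E d × E d, ‖kernelIntegrand φ a z' z p‖ ≤
      C * (Real.exp (m * ω ‖p.2‖) * Real.exp (-L * ω ‖p.2 - z.2‖) *
        Real.exp (-L * ω ‖p.1 - z'.1‖)) := by
  obtain ⟨A, hA, hA'⟩ := exists_symbol_norm_le ha
  obtain ⟨h1, h2⟩ := rapidDecay_of_mem hφ
  obtain ⟨B, hB, hB'⟩ := h1 L hL
  obtain ⟨D, hD, hD'⟩ := h2 L hL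
  refine ⟨A * D * B, by positivity, fun z' z p => ?_⟩
  rw [norm_kernelIntegrand]
  calc _ ≤ (A * Real.exp (m * ω ‖p.2‖)) * (D * Real.exp (-L * ω ‖p.2 - z.2‖)) *
        (B * Real.exp (-L * ω ‖p.1 - z'.1‖)) := by
        gcongr
        exacts [hA' p, hD' _, hB' _]
    _ = _ := by ring

lemma continuous_kernelIntegrand (ha : Continuous a) (z' z : E d × E d) :
    Continuous (kernelIntegrand φ a z' z) := by
  have h1 := (contDiff_fourierHat φ).continuous
  have h2 := φ.continuous
  unfold kernelIntegrand
  have h3 : Continuous (starRingEnd ℂ) := Complex.continuous_conj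
  fun_prop

lemma IsWeightFunction.integrable_exp_mul_exp (hω : IsWeightFunction ω) (u v : E d) :
    Integrable fun p : E d × E d =>
      Real.exp (-1 * ω ‖p.2 - v‖) * Real.exp (-1 * ω ‖p.1 - u‖) := by
  have := (hω.integrable_exp_neg (d := d) one_pos)
  refine ((this.comp_sub_right u).mul_prod (this.comp_sub_right v)).congr
    (Filter.Eventually.of_forall fun p => mul_comm _ _)

lemma integral_exp_mul_exp (ω : ℝ → ℝ) (u v : E d) :
    ∫ p : E d × E d, Real.exp (-1 * ω ‖p.2 - v‖) * Real.exp (-1 * ω ‖p.1 - u‖) =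
      (∫ x : E d, Real.exp (-1 * ω ‖x‖)) ^ 2 := by
  simp_rw [mul_comm (Real.exp (-1 * ω ‖_ - v‖))]
  rw [Measure.volume_eq_prod, integral_prod_mul (fun x : E d => Real.exp (-1 * ω ‖x - u‖))
    (fun x : E d => Real.exp (-1 * ω ‖x - v‖)),
    integral_sub_right_eq_self (fun x : E d => Real.exp (-1 * ω ‖x‖)),
    integral_sub_right_eq_self (fun x : E d => Real.exp (-1 * ω ‖x‖)), sq]

lemma integrable_kernelIntegrand (hω : IsWeightFunction ω) (ha : a ∈ symbolClass d ω m)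
    (hφ : φ ∈ weightedSchwartz d ω) (z' z : E d × E d) :
    Integrable (kernelIntegrand φ a z' z) := by
  obtain ⟨C, hC, h⟩ := exists_norm_kernelIntegrand_le ha hφ (L := |m| + 1) (by positivity)
  refine ((hω.integrable_exp_mul_exp z'.1 z.2).const_mul (C * Real.exp (m * ω ‖z.2‖))).mono'
    (continuous_kernelIntegrand ha.1.continuous z' z).aestronglyMeasurable
    (Filter.Eventually.of_forall fun p => (h z' z p).trans ?_)
  have h1 := hω.mul_norm_le m p.2 z.2
  have h2 := mul_nonneg (abs_nonneg m) (hω.nonneg_norm (p.1 - z'.1))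
  rw [← Real.exp_add, ← Real.exp_add, mul_assoc, ← Real.exp_add, ← Real.exp_add]
  refine mul_le_mul_of_nonneg_left (Real.exp_le_exp.2 ?_) hC
  linarith

lemma norm_stftKernel_le (φ : E d → ℂ) (a : E d × E d → ℂ) (z' z : E d × E d) :
    ‖stftKernel φ a z' z‖ ≤ ‖∫ p : E d × E d, kernelIntegrand φ a z' z p‖ := by
  rw [stftKernel, norm_mul, norm_mul, mul_comm Complex.I, Complex.norm_exp_ofReal_mul_I, mul_one]
  refine mul_le_of_le_one_left (norm_nonneg _) ?_
  rw [zpow_neg, norm_inv, norm_zpow, Complex.norm_real, Real.norm_of_nonneg (by positivity)]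
  refine inv_le_one_of_one_le₀ (one_le_zpow₀ ?_ (by positivity))
  linarith [Real.pi_gt_three]

/-- Exhibits the `ξ`-integral as a Fourier transform at `y - x`. -/
lemma kernelIntegrand_eq_snd (φ : E d → ℂ) (a : E d × E d → ℂ) (y' η' y η x ξ : E d) :
    kernelIntegrand φ a (y', η') (y, η) (x, ξ) =
      Complex.exp (-(Complex.I * (inner ℝ x η' : ℝ))) * starRingEnd ℂ (φ (x - y')) *
        (Complex.exp (-(Complex.I * (inner ℝ ξ (y - x) : ℝ))) *
          (a (x, ξ) * fourierHat φ (ξ - η))) := by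
  have : Complex.exp (Complex.I * ((inner ℝ x ξ - inner ℝ y ξ - inner ℝ x η' : ℝ) : ℂ)) =
      Complex.exp (-(Complex.I * (inner ℝ x η' : ℝ))) *
        Complex.exp (-(Complex.I * (inner ℝ ξ (y - x) : ℝ))) := by
    rw [← Complex.exp_add, inner_sub_right, real_inner_comm x ξ, real_inner_comm y ξ]
    push_cast
    ring_nf
  simp only [kernelIntegrand, this]
  ring

/-- Exhibits the `x`-integral as a Fourier transform at `η' - ξ`. -/
lemma kernelIntegrand_eq_fst (φ : E d → ℂ) (a : E d × E d → ℂ) (y' η' y η x ξ : E d) :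
    kernelIntegrand φ a (y', η') (y, η) (x, ξ) =
      Complex.exp (-(Complex.I * (inner ℝ y ξ : ℝ))) * fourierHat φ (ξ - η) *
        (Complex.exp (-(Complex.I * (inner ℝ x (η' - ξ) : ℝ))) *
          (a (x, ξ) * starRingEnd ℂ (φ (x - y')))) := by
  have : Complex.exp (Complex.I * ((inner ℝ x ξ - inner ℝ y ξ - inner ℝ x η' : ℝ) : ℂ)) =
      Complex.exp (-(Complex.I * (inner ℝ y ξ : ℝ))) *
        Complex.exp (-(Complex.I * (inner ℝ x (η' - ξ) : ℝ))) := by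
    rw [← Complex.exp_add, inner_sub_right]
    push_cast
    ring_nf
  simp only [kernelIntegrand, this]
  ring

/-- The inner integral decays in `y - x` and the window in `x - y'`; subadditivity chains them, one
unit being kept for the integral in `x`. -/
lemma exists_stftKernel_le_fst [NeZero d] (hω : IsWeightFunction ω) (ha : a ∈ symbolClass d ω m)
    (hφ : φ ∈ weightedSchwartz d ω) {l : ℝ} (hl : 0 < l) :
    ∃ C : ℝ, 0 ≤ C ∧ ∀ y' η' y η : E d, ‖stftKernel φ a (y', η') (y, η)‖ ≤
      C * Real.exp (m * ω ‖η‖ - l * ω ‖y - y'‖) := by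
  obtain ⟨C, hC, h⟩ := exists_fourierHat_mul_le hω (fun i : E d × E d => i.2)
    (fun _ => zero_le_one) (fun i => ha.1.comp (contDiff_const.prodMk contDiff_id))
    (ultraBound_symbol_snd ha) (contDiff_fourierHat φ)
    (fun L hL => ultraBound_fourierHat_window hω hφ hL) hl
  obtain ⟨B, hB, hB'⟩ := (rapidDecay_of_mem hφ).1 (l + 1) (by positivity)
  have hint := hω.integrable_exp_neg (d := d) one_pos
  set J := ∫ x : E d, Real.exp (-1 * ω ‖x‖) with hJ
  have hJ0 : 0 ≤ J := integral_nonneg fun x => (Real.exp_pos _).le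
  refine ⟨B * C * J, by positivity, fun y' η' y η => (norm_stftKernel_le _ _ _ _).trans ?_⟩
  rw [Measure.volume_eq_prod, integral_prod _ (integrable_kernelIntegrand hω ha hφ _ _)]
  have hpt : ∀ x : E d, ‖∫ ξ : E d, kernelIntegrand φ a (y', η') (y, η) (x, ξ)‖ ≤
      B * C * Real.exp (m * ω ‖η‖ - l * ω ‖y - y'‖) * Real.exp (-1 * ω ‖x - y'‖) := by
    intro x
    simp only [kernelIntegrand_eq_snd]
    rw [integral_const_mul, norm_mul, norm_mul, norm_exp_neg_I_mul, RCLike.norm_conj, one_mul]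
    have h1 := h (x, η) (y - x)
    have h2 := hω.norm_add_le (y - x) (x - y')
    rw [sub_add_sub_cancel] at h2
    calc _ ≤ (B * Real.exp (-(l + 1) * ω ‖x - y'‖)) *
          (C * (1 * Real.exp (m * ω ‖η‖)) * Real.exp (-l * ω ‖y - x‖)) :=
          mul_le_mul (hB' _) h1 (norm_nonneg _) (by positivity)
      _ = B * C * Real.exp (-(l + 1) * ω ‖x - y'‖ + (m * ω ‖η‖ + -l * ω ‖y - x‖)) := by
          rw [Real.exp_add, Real.exp_add]; ring
      _ ≤ B * C * Real.exp ((m * ω ‖η‖ - l * ω ‖y - y'‖) + -1 * ω ‖x - y'‖) := by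
          refine mul_le_mul_of_nonneg_left (Real.exp_le_exp.2 ?_) (by positivity)
          nlinarith
      _ = _ := by rw [Real.exp_add]; ring
  refine (norm_integral_le_integral_norm _).trans ?_
  refine (integral_mono_of_nonneg (Filter.Eventually.of_forall fun _ => norm_nonneg _)
    ((hint.comp_sub_right y').const_mul _) (Filter.Eventually.of_forall hpt)).trans_eq ?_
  rw [integral_const_mul, integral_sub_right_eq_self (fun x : E d => Real.exp (-1 * ω ‖x‖))]
  ring

/-- As before with the variables exchanged; the extra `|m|` pays for replacing `mω(ξ)` by `mω(η')`.
-/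
lemma exists_stftKernel_le_snd [NeZero d] (hω : IsWeightFunction ω) (ha : a ∈ symbolClass d ω m)
    (hφ : φ ∈ weightedSchwartz d ω) {l : ℝ} (hl : 0 < l) :
    ∃ C : ℝ, 0 ≤ C ∧ ∀ y' η' y η : E d, ‖stftKernel φ a (y', η') (y, η)‖ ≤
      C * Real.exp (m * ω ‖η'‖ - l * ω ‖η - η'‖) := by
  obtain ⟨C, hC, h⟩ := exists_fourierHat_mul_le hω (fun i : E d × E d => i.2)
    (fun _ => (Real.exp_pos _).le) (fun i => ha.1.comp (contDiff_id.prodMk contDiff_const))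
    (ultraBound_symbol_fst ha) (contDiff_conj φ.smooth')
    (fun L hL => ultraBound_conj_window hω hφ hL) (l := l + |m|) (by positivity)
  obtain ⟨B, hB, hB'⟩ := (rapidDecay_of_mem hφ).2 (l + 1) (by positivity)
  have hint := hω.integrable_exp_neg (d := d) one_pos
  set J := ∫ x : E d, Real.exp (-1 * ω ‖x‖) with hJ
  have hJ0 : 0 ≤ J := integral_nonneg fun x => (Real.exp_pos _).le
  refine ⟨B * C * J, by positivity, fun y' η' y η => (norm_stftKernel_le _ _ _ _).trans ?_⟩
  rw [Measure.volume_eq_prod, integral_prod_symm _ (integrable_kernelIntegrand hω ha hφ _ _)]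
  have hpt : ∀ ξ : E d, ‖∫ x : E d, kernelIntegrand φ a (y', η') (y, η) (x, ξ)‖ ≤
      B * C * Real.exp (m * ω ‖η'‖ - l * ω ‖η - η'‖) * Real.exp (-1 * ω ‖ξ - η‖) := by
    intro ξ
    simp only [kernelIntegrand_eq_fst]
    rw [integral_const_mul, norm_mul, norm_mul, norm_exp_neg_I_mul, one_mul]
    have h1 := h (ξ, y') (η' - ξ)
    have h2 := hω.norm_add_le (η - ξ) (ξ - η')
    have h3 := hω.mul_norm_le m ξ η'
    rw [sub_add_sub_cancel, norm_sub_rev η ξ] at h2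
    rw [norm_sub_rev η' ξ] at h1
    calc _ ≤ (B * Real.exp (-(l + 1) * ω ‖ξ - η‖)) *
          (C * (Real.exp (m * ω ‖ξ‖) * Real.exp (0 * ω ‖y'‖)) *
            Real.exp (-(l + |m|) * ω ‖ξ - η'‖)) :=
          mul_le_mul (hB' _) h1 (norm_nonneg _) (by positivity)
      _ = B * C * Real.exp (-(l + 1) * ω ‖ξ - η‖ +
            (m * ω ‖ξ‖ + -(l + |m|) * ω ‖ξ - η'‖)) := by
          rw [Real.exp_add, Real.exp_add, zero_mul, Real.exp_zero]; ring
      _ ≤ B * C * Real.exp ((m * ω ‖η'‖ - l * ω ‖η - η'‖) + -1 * ω ‖ξ - η‖) := by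
          refine mul_le_mul_of_nonneg_left (Real.exp_le_exp.2 ?_) (by positivity)
          nlinarith
      _ = _ := by rw [Real.exp_add]; ring
  refine (norm_integral_le_integral_norm _).trans ?_
  refine (integral_mono_of_nonneg (Filter.Eventually.of_forall fun _ => norm_nonneg _)
    ((hint.comp_sub_right η).const_mul _) (Filter.Eventually.of_forall hpt)).trans_eq ?_
  rw [integral_const_mul, integral_sub_right_eq_self (fun x : E d => Real.exp (-1 * ω ‖x‖))]
  ring

/-- The off-diagonal decay of the kernel. -/
lemma exists_stftKernel_le [NeZero d] (hω : IsWeightFunction ω) (ha : a ∈ symbolClass d ω m)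
    (hφ : φ ∈ weightedSchwartz d ω) {l : ℝ} (hl : 0 < l) :
    ∃ C : ℝ, 0 ≤ C ∧ ∀ y' η' y η : E d, ‖stftKernel φ a (y', η') (y, η)‖ ≤
      C * Real.exp (-l * ω ‖y - y'‖ + (m - l) * ω ‖η - η'‖ + m * ω ‖η'‖) := by
  obtain ⟨A, hA, hA'⟩ := exists_stftKernel_le_fst hω ha hφ (l := 2 * l) (by positivity)
  -- After halving, replacing `mω(η)` by `mω(η')` costs `|m|/2`, so `-(l + |m|) ≤ m - l` remains in
  -- front of `ω(η-η')`.
  obtain ⟨B, hB, hB'⟩ := exists_stftKernel_le_snd hω ha hφ (l := 2 * l + 3 * |m|) (by positivity)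
  refine ⟨A + B, by positivity, fun y' η' y η =>
    (le_exp_half_add hA hB (hA' y' η' y η) (hB' y' η' y η)).trans
      (mul_le_mul_of_nonneg_left (Real.exp_le_exp.2 ?_) (by positivity))⟩
  have h1 := hω.mul_norm_le m η η'
  have h2 := hω.nonneg_norm (η - η')
  nlinarith [neg_abs_le m]

lemma exists_stftKernel_le_cone [NeZero d] (hω : IsWeightFunction ω)
    (ha : a ∈ symbolClass d ω m) (hφ : φ ∈ weightedSchwartz d ω) (S : Set (E d × E d)) {N D : ℝ}
    (hN : 0 ≤ N) (hS : ∀ z' ∈ S, ∀ p, a p ≠ 0 →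
      ω ‖z'.1‖ + ω ‖z'.2‖ ≤ N * (ω ‖p.1 - z'.1‖ + ω ‖p.2 - z'.2‖) + D) {l : ℝ} (hl : 0 < l) :
    ∃ C : ℝ, 0 ≤ C ∧ ∀ z' ∈ S, ∀ z : E d × E d, ‖stftKernel φ a z' z‖ ≤
      C * Real.exp (-l * ω ‖z.1 - z'.1‖ + -l * ω ‖z.2 - z'.2‖ + -2 * l * ω ‖z'.1‖ +
        -2 * l * ω ‖z'.2‖) := by
  -- Half of `k` must yield `2l` and cancel the growth `mω(η')`. In `L`, `kN` buys the decay in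
  -- `z'`, `|m|` moves the symbol weight, and `1` gives integrability.
  set k := 4 * l + 2 * |m| with hk
  have hk0 : 0 < k := by positivity
  set L := |m| + 1 + k * N with hL
  have hL0 : 0 < L := by positivity
  obtain ⟨A, hA, hA'⟩ := exists_norm_kernelIntegrand_le ha hφ hL0
  obtain ⟨B, hB, hB'⟩ := exists_stftKernel_le hω ha hφ (l := 2 * l + L + |m|) (by positivity)
  set J := ∫ x : E d, Real.exp (-1 * ω ‖x‖) with hJ
  have hJ0 : 0 ≤ J := integral_nonneg fun x => (Real.exp_pos _).le
  -- Absolute values only: the `ξ`-window is recentred from `η` to `η'`, at the cost `Lω(η-η')`.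
  have h1 : ∀ z' ∈ S, ∀ z : E d × E d, ‖stftKernel φ a z' z‖ ≤ A * Real.exp (k * D) * J ^ 2 *
      Real.exp (m * ω ‖z'.2‖ + L * ω ‖z.2 - z'.2‖ - k * (ω ‖z'.1‖ + ω ‖z'.2‖)) := by
    intro z' hz' z
    have hpt : ∀ p, ‖kernelIntegrand φ a z' z p‖ ≤ A * Real.exp (k * D) *
        Real.exp (m * ω ‖z'.2‖ + L * ω ‖z.2 - z'.2‖ - k * (ω ‖z'.1‖ + ω ‖z'.2‖)) *
        (Real.exp (-1 * ω ‖p.2 - z'.2‖) * Real.exp (-1 * ω ‖p.1 - z'.1‖)) := by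
      intro p
      by_cases hp : a p = 0
      · rw [norm_kernelIntegrand, hp]
        simp only [norm_zero, zero_mul]
        positivity
      refine (hA' z' z p).trans ?_
      have e1 := mul_le_mul_of_nonneg_left (hS z' hz' p hp) hk0.le
      have e2 := hω.mul_norm_le m p.2 z'.2
      have e3 := hω.norm_add_le (p.2 - z.2) (z.2 - z'.2)
      rw [sub_add_sub_cancel] at e3
      have e4 := mul_le_mul_of_nonneg_left e3 hL0.le
      have e5 := mul_nonneg (abs_nonneg m) (hω.nonneg_norm (p.1 - z'.1))
      rw [← Real.exp_add, ← Real.exp_add, ← Real.exp_add, mul_assoc, ← Real.exp_add,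
        mul_assoc, ← Real.exp_add]
      refine mul_le_mul_of_nonneg_left (Real.exp_le_exp.2 ?_) hA
      have e6 : L * ω ‖p.2 - z'.2‖ = |m| * ω ‖p.2 - z'.2‖ + ω ‖p.2 - z'.2‖ +
        k * N * ω ‖p.2 - z'.2‖ := by rw [hL]; ring
      have e7 : L * ω ‖p.1 - z'.1‖ = |m| * ω ‖p.1 - z'.1‖ + ω ‖p.1 - z'.1‖ +
        k * N * ω ‖p.1 - z'.1‖ := by rw [hL]; ring
      linarith
    refine (norm_stftKernel_le _ _ _ _).trans ((norm_integral_le_integral_norm _).trans ?_)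
    refine (integral_mono_of_nonneg (Filter.Eventually.of_forall fun _ => norm_nonneg _)
      ((hω.integrable_exp_mul_exp z'.1 z'.2).const_mul _)
      (Filter.Eventually.of_forall hpt)).trans_eq ?_
    rw [integral_const_mul, integral_exp_mul_exp ω]
    ring
  refine ⟨A * Real.exp (k * D) * J ^ 2 + B, by positivity, fun z' hz' z =>
    (le_exp_half_add (by positivity) hB (h1 z' hz' z) (hB' z'.1 z'.2 z.1 z.2)).trans
      (mul_le_mul_of_nonneg_left (Real.exp_le_exp.2 ?_) (by positivity))⟩
  have n1 := hω.nonneg_norm (z.1 - z'.1)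
  have n2 := hω.nonneg_norm (z.2 - z'.2)
  have n3 := hω.nonneg_norm z'.2
  have n4 := hω.nonneg_norm z'.1
  have m1 := mul_le_mul_of_nonneg_right (le_abs_self m) n2
  have m2 := mul_le_mul_of_nonneg_right (le_abs_self m) n3
  have m3 := mul_nonneg (abs_nonneg m) n1
  have m4 := mul_nonneg (abs_nonneg m) n4
  have m5 := mul_nonneg hL0.le n1
  have e : k * (ω ‖z'.1‖ + ω ‖z'.2‖) = 4 * (l * ω ‖z'.1‖) + 4 * (l * ω ‖z'.2‖) +
    2 * (|m| * ω ‖z'.1‖) + 2 * (|m| * ω ‖z'.2‖) := by rw [hk]; ring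
  rw [e]
  linarith

end Kernel

end

section

variable {d : ℕ} {ω : ℝ → ℝ}

/-! ### Smoothness of parametric integrals -/

section ParametricIntegral

variable {W P G : Type} [NormedAddCommGroup W] [NormedSpace ℝ W] [MeasurableSpace P]
  {μ : Measure P} [NormedAddCommGroup G] [NormedSpace ℝ G]

/-- The iterated derivatives in the parameter are locally uniformly dominated by integrable
functions. -/
def LocallyDominated (μ : Measure P) (F : W → P → G) : Prop :=
  ∀ (n : ℕ) (w₀ : W), ∃ bound : P → ℝ, Integrable bound μ ∧
    ∀ w ∈ Metric.ball w₀ 1, ∀ p, ‖iteratedFDeriv ℝ n (fun w => F w p) w‖ ≤ bound p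

lemma LocallyDominated.fderiv_left {F : W → P → G} (h : LocallyDominated μ F) :
    LocallyDominated μ (fun w p => fderiv ℝ (fun w => F w p) w) := by
  intro n w₀
  obtain ⟨bound, hb, h'⟩ := h (n + 1) w₀
  exact ⟨bound, hb, fun w hw p => by
    rw [norm_iteratedFDeriv_fderiv]; exact h' w hw p⟩

variable [NormedAddCommGroup P] [NormedSpace ℝ P] [BorelSpace P] [SecondCountableTopology P]

lemma LocallyDominated.hasFDerivAt {F : W → P → G} (h : LocallyDominated μ F)
    (hF : ContDiff ℝ ∞ (Function.uncurry F)) (w₀ : W) :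
    HasFDerivAt (fun w => ∫ p, F w p ∂μ) (∫ p, fderiv ℝ (fun w => F w p) w₀ ∂μ) w₀ := by
  obtain ⟨b0, hb0, h0⟩ := h 0 w₀
  obtain ⟨b1, hb1, h1⟩ := h 1 w₀
  have hcont : ∀ w, Continuous (F w) := fun w => 
    hF.continuous.comp (by fun_prop : Continuous fun p : P => (w, p))
  have hF' : ContDiff ℝ ∞ fun q : W × P => fderiv ℝ (fun w => F w q.2) q.1 :=
    ContDiff.fderiv (f := fun (q : W × P) w => F w q.2) (m := ∞)
      (hF.comp (contDiff_snd.prodMk (contDiff_snd.comp contDiff_fst))) contDiff_fst (by simp)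
  refine hasFDerivAt_integral_of_dominated_of_fderiv_le (bound := b1)
    (F' := fun w p => fderiv ℝ (fun w => F w p) w)
    (Metric.ball_mem_nhds w₀ one_pos)
    (Filter.Eventually.of_forall fun w => (hcont w).aestronglyMeasurable) ?_
    (hF'.continuous.comp (by fun_prop : Continuous fun p : P => (w₀, p))).aestronglyMeasurable
    (Filter.Eventually.of_forall fun p w hw => ?_) hb1
    (Filter.Eventually.of_forall fun p w _ => ?_)
  · refine hb0.mono' (hcont w₀).aestronglyMeasurable (Filter.Eventually.of_forall fun p => ?_)
    simpa using h0 w₀ (Metric.mem_ball_self one_pos) p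
  · simpa using h1 w hw p
  · refine DifferentiableAt.hasFDerivAt ?_
    have : Differentiable ℝ (fun w => F w p) :=
      (hF.comp (contDiff_id.prodMk contDiff_const)).differentiable (by simp)
    exact this w

/-- Local domination passes to the derivative in the parameter, so differentiation under the
integral can be iterated. -/
lemma LocallyDominated.contDiff {F : W → P → G} (h : LocallyDominated μ F)
    (hF : ContDiff ℝ ∞ (Function.uncurry F)) : ContDiff ℝ ∞ fun w => ∫ p, F w p ∂μ := by
  refine contDiff_infty.2 fun n => ?_
  induction n generalizing G with
  | zero =>
    exact contDiff_zero.2 (continuous_iff_continuousAt.2 fun w =>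
      (h.hasFDerivAt hF w).continuousAt)
  | succ n ih =>
    rw [Nat.cast_add, Nat.cast_one]
    refine contDiff_succ_iff_fderiv.2
      ⟨fun w => (h.hasFDerivAt hF w).differentiableAt, by simp, ?_⟩
    rw [show fderiv ℝ (fun w => ∫ p, F w p ∂μ) = fun w => ∫ p, fderiv ℝ (fun w => F w p) w ∂μ from
      funext fun w => (h.hasFDerivAt hF w).fderiv]
    refine ih h.fderiv_left ?_
    exact ContDiff.fderiv (f := fun (q : W × P) w => F w q.2) (m := ∞)
      (hF.comp (contDiff_snd.prodMk (contDiff_snd.comp contDiff_fst))) contDiff_fst (by simp)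

end ParametricIntegral

/-! ### From partial to Fréchet derivatives -/

section MultiDeriv

lemma partialDeriv_comm {f : E d → ℂ} (hf : ContDiff ℝ ∞ f) (i j : Fin d) :
    partialDeriv i (partialDeriv j f) = partialDeriv j (partialDeriv i f) := by
  have key : ∀ i j : Fin d, partialDeriv i (partialDeriv j f) = fun x =>
      fderiv ℝ (fderiv ℝ f) x (EuclideanSpace.single i 1) (EuclideanSpace.single j 1) := by
    intro i j
    rw [partialDeriv_eq_fderiv ((contDiff_partialDeriv hf j).differentiable (by simp)),
      partialDeriv_eq_fderiv (hf.differentiable (by simp))]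
    funext x
    have hd : DifferentiableAt ℝ (fderiv ℝ f) x :=
      ((hf.fderiv_right (m := ∞) (by simp)).differentiable (by simp)) x
    rw [fderiv_clm_apply hd (differentiableAt_const _)]
    simp
  rw [key, key]
  funext x
  exact hf.contDiffAt.isSymmSndFDerivAt
    (by
      rw [minSmoothness_of_isRCLikeNormedField]
      exact (mod_cast le_top : ((2 : ℕ∞) : WithTop ℕ∞) ≤ ∞)) _ _

lemma partialDeriv_iterate_comm {f : E d → ℂ} (hf : ContDiff ℝ ∞ f) (i j : Fin d) (k : ℕ) :
    (partialDeriv j)^[k] (partialDeriv i f) = partialDeriv i ((partialDeriv j)^[k] f) := by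
  induction k with
  | zero => rfl
  | succ k ih =>
    rw [Function.iterate_succ_apply', ih, Function.iterate_succ_apply',
      partialDeriv_comm (contDiff_partialDeriv_iterate hf j k)]

/-- Symmetry of second derivatives moves the new derivative to its place in the fixed order of
coordinates. -/
lemma multiDeriv_partialDeriv {f : E d → ℂ} (hf : ContDiff ℝ ∞ f) (i : Fin d) (α : Fin d → ℕ) :
    multiDeriv α (partialDeriv i f) = multiDeriv (α + Pi.single i 1) f := by
  have hs : ∀ (α : Fin d → ℕ) (L : List (Fin d)), ContDiff ℝ ∞
      (L.foldr (fun i g => (partialDeriv i)^[α i] g) f) := by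
    intro α L
    induction L with
    | nil => exact hf
    | cons j L ih => exact contDiff_partialDeriv_iterate ih j _
  have h1 : ∀ L : List (Fin d),
      L.foldr (fun i g => (partialDeriv i)^[α i] g) (partialDeriv i f) =
        partialDeriv i (L.foldr (fun i g => (partialDeriv i)^[α i] g) f) := by
    intro L
    induction L with
    | nil => rfl
    | cons j L ih =>
      rw [List.foldr_cons, List.foldr_cons, ih, partialDeriv_iterate_comm (hs α L)]
  have h2 : ∀ L : List (Fin d), L.Nodup →
      L.foldr (fun j g => (partialDeriv j)^[(α + Pi.single i 1 : Fin d → ℕ) j] g) f =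
        if i ∈ L then partialDeriv i (L.foldr (fun i g => (partialDeriv i)^[α i] g) f)
        else L.foldr (fun i g => (partialDeriv i)^[α i] g) f := by
    intro L hL
    induction L with
    | nil => simp
    | cons j L ih =>
      rw [List.nodup_cons] at hL
      rw [List.foldr_cons, ih hL.2, List.foldr_cons]
      rcases eq_or_ne i j with rfl | h
      · simp [hL.1, Function.iterate_succ_apply']
      · by_cases hi : i ∈ L
        · simp [h, Ne.symm h, hi, partialDeriv_iterate_comm (hs α L)]
        · simp [h, Ne.symm h, hi]
  rw [multiDeriv, multiDeriv, h1, h2 _ (List.nodup_finRange d), if_pos (List.mem_finRange i)]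

/-- Rapid decay of all partial derivatives implies rapid decay of the iterated Fréchet
derivatives. -/
lemma exists_norm_iteratedFDeriv_le {f : E d → ℂ} (hf : ContDiff ℝ ∞ f)
    (h : ∀ α, RapidDecay ω (multiDeriv α f)) (n : ℕ) {l : ℝ} (hl : 0 < l) :
    ∃ C : ℝ, 0 ≤ C ∧ ∀ x, ‖iteratedFDeriv ℝ n f x‖ ≤ C * Real.exp (-l * ω ‖x‖) := by
  induction n generalizing f with
  | zero =>
    obtain ⟨C, hC, hb⟩ := h 0 l hl
    exact ⟨C, hC, fun x => by simpa [multiDeriv_zero] using hb x⟩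
  | succ n ih =>
    have hi : ∀ i : Fin d, ∃ C : ℝ, 0 ≤ C ∧ ∀ x,
        ‖iteratedFDeriv ℝ n (partialDeriv i f) x‖ ≤ C * Real.exp (-l * ω ‖x‖) := fun i =>
      ih (contDiff_partialDeriv hf i) fun α => by rw [multiDeriv_partialDeriv hf]; exact h _
    choose C hC hb using hi
    let T : Fin d → ℂ →L[ℝ] (E d →L[ℝ] ℂ) := fun i =>
      ContinuousLinearMap.smulRightL ℝ (E d) ℂ (EuclideanSpace.proj i)
    -- Writing `Df = ∑ T_i ∘ ∂_i f` with fixed linear `T_i` reduces order `n + 1` to order `n` for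
    -- each `∂_i f`.
    have hsum : fderiv ℝ f = fun x => ∑ i, (T i ∘ partialDeriv i f) x := by
      funext x
      ext v
      have hv : v = ∑ i, v i • EuclideanSpace.single i (1 : ℝ) := by
        conv_lhs => rw [← (EuclideanSpace.basisFun (Fin d) ℝ).sum_repr v]
        simp
      have hp : ∀ i, partialDeriv i f x = fderiv ℝ f x (EuclideanSpace.single i 1) := fun i =>
        congrFun (partialDeriv_eq_fderiv (hf.differentiable (by simp)) i) x
      conv_lhs => rw [hv, map_sum]
      simp only [map_smul]
      simp [T, hp]
    refine ⟨∑ i, ‖T i‖ * C i, Finset.sum_nonneg fun i _ => mul_nonneg (T i).opNorm_nonneg (hC i),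
      fun x => ?_⟩
    rw [← norm_iteratedFDeriv_fderiv, hsum, iteratedFDeriv_fun_sum_apply fun i _ =>
      (((T i).contDiff.comp (contDiff_partialDeriv hf i)).of_le (by exact_mod_cast le_top)).contDiffAt,
      Finset.sum_mul]
    refine norm_sum_le_of_le _ fun i _ => ?_
    refine ((T i).norm_iteratedFDeriv_comp_left (contDiff_partialDeriv hf i).contDiffAt
      (by exact_mod_cast le_top)).trans ?_
    rw [mul_assoc]
    exact mul_le_mul_of_nonneg_left (hb i x) (T i).opNorm_nonneg

end MultiDeriv

end

section

variable {d : ℕ} {ω : ℝ → ℝ}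

/-! ### Smoothness of the kernel -/

section Smoothness

variable {V W : Type} [NormedAddCommGroup V] [NormedSpace ℝ V] [NormedAddCommGroup W]
  [NormedSpace ℝ W]

lemma norm_iteratedFDeriv_mul_le_of_le {f g : W → ℂ} (hf : ContDiff ℝ ∞ f) (hg : ContDiff ℝ ∞ g)
    {w : W} {n : ℕ} {A B : ℝ} (hA : ∀ i ≤ n, ‖iteratedFDeriv ℝ i f w‖ ≤ A)
    (hB : ∀ i ≤ n, ‖iteratedFDeriv ℝ i g w‖ ≤ B) :
    ∀ i ≤ n, ‖iteratedFDeriv ℝ i (fun w => f w * g w) w‖ ≤ 2 ^ n * (A * B) := by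
  intro i hi
  have hA0 : 0 ≤ A := (norm_nonneg _).trans (hA 0 n.zero_le)
  have hB0 : 0 ≤ B := (norm_nonneg _).trans (hB 0 n.zero_le)
  refine (norm_iteratedFDeriv_mul_le hf hg w (by exact_mod_cast le_top)).trans ?_
  calc _ ≤ ∑ j ∈ Finset.range (i + 1), (i.choose j : ℝ) * (A * B) := by
        refine Finset.sum_le_sum fun j hj => ?_
        rw [Finset.mem_range] at hj
        rw [mul_assoc]
        gcongr
        · exact hA j (by omega)
        · exact hB (i - j) (by omega)
    _ = 2 ^ i * (A * B) := by
        rw [← Finset.sum_mul, ← Nat.cast_sum, Nat.sum_range_choose]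
        push_cast; ring
    _ ≤ _ := by gcongr; norm_num

lemma norm_iteratedFDeriv_comp_affine_le {u : V → ℂ} (hu : ContDiff ℝ ∞ u) (c : V) (T : W →L[ℝ] V)
    (i : ℕ) (w : W) : ‖iteratedFDeriv ℝ i (fun w => u (c + T w)) w‖ ≤
      ‖iteratedFDeriv ℝ i u (c + T w)‖ * ‖T‖ ^ i := by
  have h := T.iteratedFDeriv_comp_right (f := fun v => u (c + v)) (n := ∞)
    (hu.comp (contDiff_const.add contDiff_id)) w (i := i) (by exact_mod_cast le_top)
  rw [show (fun w => u (c + T w)) = (fun v => u (c + v)) ∘ T from rfl, h,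
    iteratedFDeriv_comp_add_left]
  refine (ContinuousMultilinearMap.norm_compContinuousLinearMap_le _ _).trans_eq ?_
  simp

lemma norm_iteratedFDeriv_exp_mul_I (i : ℕ) (t : ℝ) :
    ‖iteratedFDeriv ℝ i (fun t : ℝ => Complex.exp (Complex.I * t)) t‖ = 1 := by
  rw [norm_iteratedFDeriv_eq_norm_iteratedDeriv,
    iteratedDeriv_comp_ofReal (h := fun z => Complex.exp (Complex.I * z)) (by fun_prop),
    iteratedDeriv_cexp_const_mul]
  simp [mul_comm Complex.I, Complex.norm_exp_ofReal_mul_I]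

lemma norm_iteratedFDeriv_const_le (c : ℂ) (i : ℕ) (w : W) :
    ‖iteratedFDeriv ℝ i (fun _ : W => c) w‖ ≤ ‖c‖ := by
  rcases eq_or_ne i 0 with rfl | h
  · simp
  · simp [iteratedFDeriv_const_of_ne h]

variable {m : ℝ} {a : E d × E d → ℂ} {φ : 𝓢(E d, ℂ)}

/-- The linear part of the phase, as a function of `(z', z)`. -/
def phaseCLM (p : E d × E d) : ((E d × E d) × (E d × E d)) →L[ℝ] ℝ :=
  -((innerSL ℝ p.2).comp ((ContinuousLinearMap.fst ℝ _ _).comp (ContinuousLinearMap.snd ℝ _ _)) +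
    (innerSL ℝ p.1).comp ((ContinuousLinearMap.snd ℝ _ _).comp (ContinuousLinearMap.fst ℝ _ _)))

lemma phaseCLM_apply (p : E d × E d) (w : (E d × E d) × (E d × E d)) :
    inner ℝ p.1 p.2 + phaseCLM p w =
      inner ℝ p.1 p.2 - inner ℝ w.2.1 p.2 - inner ℝ p.1 w.1.2 := by
  simp [phaseCLM, real_inner_comm]
  ring

lemma norm_phaseCLM_le (p : E d × E d) : ‖phaseCLM p‖ ≤ (1 + ‖p.1‖) * (1 + ‖p.2‖) := by
  refine ContinuousLinearMap.opNorm_le_bound _ (by positivity) fun w => ?_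
  have h1 : ‖w.2.1‖ ≤ ‖w‖ := (norm_fst_le _).trans (norm_snd_le _)
  have h2 : ‖w.1.2‖ ≤ ‖w‖ := (norm_snd_le _).trans (norm_fst_le _)
  have h3 : ‖phaseCLM p w‖ ≤ ‖p.2‖ * ‖w.2.1‖ + ‖p.1‖ * ‖w.1.2‖ := by
    simp only [phaseCLM, neg_apply, norm_neg, add_apply, ContinuousLinearMap.comp_apply,
      ContinuousLinearMap.coe_fst',
      ContinuousLinearMap.coe_snd', innerSL_apply_apply]
    exact (norm_add_le _ _).trans (add_le_add (norm_inner_le_norm _ _) (norm_inner_le_norm _ _))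
  calc ‖phaseCLM p w‖ ≤ ‖p.2‖ * ‖w‖ + ‖p.1‖ * ‖w‖ := h3.trans (by gcongr)
    _ ≤ _ := by nlinarith [norm_nonneg p.1, norm_nonneg p.2, norm_nonneg w,
        mul_nonneg (mul_nonneg (norm_nonneg p.1) (norm_nonneg p.2)) (norm_nonneg w)]

lemma contDiff_kernelIntegrand (ha : ContDiff ℝ ∞ a) :
    ContDiff ℝ ∞ (Function.uncurry fun (w : (E d × E d) × (E d × E d)) p =>
      kernelIntegrand φ a w.1 w.2 p) := by
  have h1 := contDiff_fourierHat φ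
  have h2 : ContDiff ℝ ∞ φ := φ.smooth'
  have h3 := contDiff_conj h2
  have e : ContDiff ℝ ∞ fun q : ((E d × E d) × (E d × E d)) × (E d × E d) =>
      (inner ℝ q.2.1 q.2.2 - inner ℝ q.1.2.1 q.2.2 - inner ℝ q.2.1 q.1.1.2 : ℝ) :=
    (((contDiff_fst.comp contDiff_snd).inner ℝ (contDiff_snd.comp contDiff_snd)).sub
      ((contDiff_fst.comp (contDiff_snd.comp contDiff_fst)).inner ℝ
        (contDiff_snd.comp contDiff_snd))).sub
      ((contDiff_fst.comp contDiff_snd).inner ℝ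
        (contDiff_snd.comp (contDiff_fst.comp contDiff_fst)))
  have e' : ContDiff ℝ ∞ fun q : ((E d × E d) × (E d × E d)) × (E d × E d) =>
      Complex.exp (Complex.I *
        ((inner ℝ q.2.1 q.2.2 - inner ℝ q.1.2.1 q.2.2 - inner ℝ q.2.1 q.1.1.2 : ℝ) : ℂ)) :=
    (contDiff_const.mul (Complex.ofRealCLM.contDiff.comp e)).cexp
  exact ((e'.mul (ha.comp contDiff_snd)).mul
    (h1.comp ((contDiff_snd.comp contDiff_snd).sub
      (contDiff_snd.comp (contDiff_snd.comp contDiff_fst))))).mul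
    (h3.comp ((contDiff_fst.comp contDiff_snd).sub
      (contDiff_fst.comp (contDiff_fst.comp contDiff_fst))))

/-- The phase is affine in `(z', z)`, so each derivative costs at most `(1+‖p.1‖)(1+‖p.2‖)`; the
windows are composed with affine maps of linear norm at most one. Each of the three products
contributes `2^n`. -/
lemma norm_iteratedFDeriv_kernelIntegrand_le {n : ℕ} {L A B : ℝ}
    (hA : ∀ i ≤ n, ∀ x, ‖iteratedFDeriv ℝ i (fourierHat (φ : E d → ℂ)) x‖ ≤
      A * Real.exp (-L * ω ‖x‖))
    (hB : ∀ i ≤ n, ∀ x, ‖iteratedFDeriv ℝ i (fun x => starRingEnd ℂ (φ x)) x‖ ≤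
      B * Real.exp (-L * ω ‖x‖)) (w : (E d × E d) × (E d × E d)) (p : E d × E d) :
    ‖iteratedFDeriv ℝ n (fun w : (E d × E d) × (E d × E d) => kernelIntegrand φ a w.1 w.2 p) w‖ ≤
      2 ^ n * (2 ^ n * (2 ^ n * (((1 + ‖p.1‖) * (1 + ‖p.2‖)) ^ n * ‖a p‖) *
        (A * Real.exp (-L * ω ‖p.2 - w.2.2‖))) * (B * Real.exp (-L * ω ‖p.1 - w.1.1‖))) := by
  let T₂ : ((E d × E d) × (E d × E d)) →L[ℝ] E d :=
    -((ContinuousLinearMap.snd ℝ _ _).comp (ContinuousLinearMap.snd ℝ _ _))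
  let T₁ : ((E d × E d) × (E d × E d)) →L[ℝ] E d :=
    -((ContinuousLinearMap.fst ℝ _ _).comp (ContinuousLinearMap.fst ℝ _ _))
  have hT₂ : ‖T₂‖ ≤ 1 := ContinuousLinearMap.opNorm_le_bound _ zero_le_one fun w => by
    simpa [T₂] using (norm_snd_le w.2).trans (norm_snd_le w)
  have hT₁ : ‖T₁‖ ≤ 1 := ContinuousLinearMap.opNorm_le_bound _ zero_le_one fun w => by
    simpa [T₁] using (norm_fst_le w.1).trans (norm_fst_le w)
  have heq : (fun w : (E d × E d) × (E d × E d) => kernelIntegrand φ a w.1 w.2 p) = fun w =>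
      (fun t : ℝ => Complex.exp (Complex.I * t)) (inner ℝ p.1 p.2 + phaseCLM p w) * a p *
        fourierHat φ (p.2 + T₂ w) * (fun x => starRingEnd ℂ (φ x)) (p.1 + T₁ w) := by
    funext w
    simp only [kernelIntegrand, phaseCLM_apply]
    simp [T₁, T₂, sub_eq_add_neg]
  have hexp : ContDiff ℝ ∞ fun t : ℝ => Complex.exp (Complex.I * t) :=
    (contDiff_const.mul Complex.ofRealCLM.contDiff).cexp
  have hφc : ContDiff ℝ ∞ fun x => starRingEnd ℂ (φ x) := contDiff_conj φ.smooth'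
  have haff : ∀ {V : Type} [NormedAddCommGroup V] [NormedSpace ℝ V] (c : V)
      (T : ((E d × E d) × (E d × E d)) →L[ℝ] V), ContDiff ℝ ∞ fun w => c + T w :=
    fun c T => contDiff_const.add T.contDiff
  have hbase : 1 ≤ (1 + ‖p.1‖) * (1 + ‖p.2‖) := by
    nlinarith [norm_nonneg p.1, norm_nonneg p.2, mul_nonneg (norm_nonneg p.1) (norm_nonneg p.2)]
  have b1 : ∀ i ≤ n, ‖iteratedFDeriv ℝ i (fun w =>
      (fun t : ℝ => Complex.exp (Complex.I * t)) (inner ℝ p.1 p.2 + phaseCLM p w)) w‖ ≤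
        ((1 + ‖p.1‖) * (1 + ‖p.2‖)) ^ n := by
    intro i hi
    refine (norm_iteratedFDeriv_comp_affine_le hexp _ _ i w).trans ?_
    rw [norm_iteratedFDeriv_exp_mul_I, one_mul]
    exact (pow_le_pow_left₀ (norm_nonneg _) (norm_phaseCLM_le p) i).trans
      (pow_le_pow_right₀ hbase hi)
  have b2 : ∀ i ≤ n, ‖iteratedFDeriv ℝ i (fun w => fourierHat φ (p.2 + T₂ w)) w‖ ≤
      A * Real.exp (-L * ω ‖p.2 - w.2.2‖) := by
    intro i hi
    refine (norm_iteratedFDeriv_comp_affine_le (contDiff_fourierHat φ) _ _ i w).trans ?_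
    have := hA i hi (p.2 + T₂ w)
    rw [show p.2 + T₂ w = p.2 - w.2.2 by simp [T₂, sub_eq_add_neg]] at this ⊢
    exact (mul_le_of_le_one_right (norm_nonneg _) (pow_le_one₀ (norm_nonneg _) hT₂)).trans this
  have b3 : ∀ i ≤ n, ‖iteratedFDeriv ℝ i (fun w =>
      (fun x => starRingEnd ℂ (φ x)) (p.1 + T₁ w)) w‖ ≤
      B * Real.exp (-L * ω ‖p.1 - w.1.1‖) := by
    intro i hi
    refine (norm_iteratedFDeriv_comp_affine_le hφc _ _ i w).trans ?_
    have := hB i hi (p.1 + T₁ w)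
    rw [show p.1 + T₁ w = p.1 - w.1.1 by simp [T₁, sub_eq_add_neg]] at this ⊢
    exact (mul_le_of_le_one_right (norm_nonneg _) (pow_le_one₀ (norm_nonneg _) hT₁)).trans this
  have c1 := hexp.comp (haff (inner ℝ p.1 p.2) (phaseCLM p))
  have c2 := (contDiff_fourierHat φ).comp (haff p.2 T₂)
  have c3 := hφc.comp (haff p.1 T₁)
  rw [heq]
  exact norm_iteratedFDeriv_mul_le_of_le ((c1.mul contDiff_const).mul c2) c3
    (norm_iteratedFDeriv_mul_le_of_le (c1.mul contDiff_const) c2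
      (norm_iteratedFDeriv_mul_le_of_le c1 contDiff_const b1
        fun i _ => norm_iteratedFDeriv_const_le (a p) i w) b2) b3 n le_rfl

lemma exists_uniform_norm_iteratedFDeriv_le {f : E d → ℂ} (hf : ContDiff ℝ ∞ f)
    (h : ∀ α, RapidDecay ω (multiDeriv α f)) (n : ℕ) {l : ℝ} (hl : 0 < l) :
    ∃ C : ℝ, 0 ≤ C ∧ ∀ i ≤ n, ∀ x, ‖iteratedFDeriv ℝ i f x‖ ≤ C * Real.exp (-l * ω ‖x‖) := by
  choose C hC hb using fun i => exists_norm_iteratedFDeriv_le (n := i) hf h hl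
  refine ⟨∑ i ∈ Finset.range (n + 1), C i, Finset.sum_nonneg fun i _ => hC i, fun i hi x =>
    (hb i x).trans ?_⟩
  gcongr
  exact Finset.single_le_sum (f := C) (fun i _ => hC i) (Finset.mem_range.2 (by omega))

lemma locallyDominated_kernelIntegrand (hω : IsWeightFunction ω) (ha : a ∈ symbolClass d ω m)
    (hφ : φ ∈ weightedSchwartz d ω) :
    LocallyDominated volume fun (w : (E d × E d) × (E d × E d)) p =>
      kernelIntegrand φ a w.1 w.2 p := by
  intro n w₀
  -- `|m|` for the symbol, one unit for the polynomial factor and one for integrability.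
  set L := |m| + 2 with hL
  have hL0 : 0 < L := by positivity
  obtain ⟨A, hA0, hA⟩ := exists_uniform_norm_iteratedFDeriv_le (contDiff_fourierHat φ)
    (fun α => (rapidDecay_multiDeriv hφ α).2) n hL0
  obtain ⟨B, hB0, hB'⟩ := exists_uniform_norm_iteratedFDeriv_le φ.smooth'
    (fun α => (rapidDecay_multiDeriv hφ α).1) n hL0
  have hB : ∀ i ≤ n, ∀ x, ‖iteratedFDeriv ℝ i (fun x => starRingEnd ℂ (φ x)) x‖ ≤
      B * Real.exp (-L * ω ‖x‖) := by
    intro i hi x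
    rw [show (fun x => starRingEnd ℂ (φ x)) = Complex.conjLIE ∘ φ from rfl,
      LinearIsometryEquiv.norm_iteratedFDeriv_comp_left]
    exact hB' i hi x
  obtain ⟨K, hK0, hK⟩ := hω.exists_one_add_pow_le n one_pos
  obtain ⟨M, hM0, hM⟩ := exists_symbol_norm_le ha
  set Q := ω (‖w₀‖ + 1) with hQ
  refine ⟨fun p => 2 ^ n * 2 ^ n * 2 ^ n * K * K * M * A * B * Real.exp (2 * (L * Q)) *
    (Real.exp (-1 * ω ‖p.2 - 0‖) * Real.exp (-1 * ω ‖p.1 - 0‖)),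
    (hω.integrable_exp_mul_exp 0 0).const_mul _, fun w hw p =>
    (norm_iteratedFDeriv_kernelIntegrand_le hA hB w p).trans ?_⟩
  have hwn : ‖w‖ ≤ ‖w₀‖ + 1 := by
    have h1 := norm_le_norm_add_norm_sub' w w₀
    rw [Metric.mem_ball, dist_eq_norm] at hw
    linarith
  have h2 : ω ‖w.2.2‖ ≤ Q :=
    hω.mono (norm_nonneg _) (((norm_snd_le _).trans (norm_snd_le _)).trans hwn)
  have h1 : ω ‖w.1.1‖ ≤ Q :=
    hω.mono (norm_nonneg _) (((norm_fst_le _).trans (norm_fst_le _)).trans hwn)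
  have h3 := hω.norm_le_add_sub p.2 w.2.2
  have h4 := hω.norm_le_add_sub p.1 w.1.1
  have n1 := hω.nonneg_norm p.1
  have n2 := hω.nonneg_norm p.2
  simp only [sub_zero]
  calc _ ≤ 2 ^ n * (2 ^ n * (2 ^ n * ((K * Real.exp (1 * ω ‖p.1‖)) * (K * Real.exp (1 * ω ‖p.2‖)) *
        (M * Real.exp (m * ω ‖p.2‖))) * (A * Real.exp (-L * ω ‖p.2 - w.2.2‖))) *
        (B * Real.exp (-L * ω ‖p.1 - w.1.1‖))) := by
        rw [mul_pow]
        gcongr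
        exacts [hK _ (norm_nonneg _), hK _ (norm_nonneg _), hM p]
    _ = 2 ^ n * 2 ^ n * 2 ^ n * K * K * M * A * B * Real.exp (1 * ω ‖p.1‖ + (1 * ω ‖p.2‖ +
        (m * ω ‖p.2‖ + (-L * ω ‖p.2 - w.2.2‖ + -L * ω ‖p.1 - w.1.1‖)))) := by
        rw [Real.exp_add, Real.exp_add, Real.exp_add, Real.exp_add]; ring
    _ ≤ 2 ^ n * 2 ^ n * 2 ^ n * K * K * M * A * B *
        Real.exp (2 * (L * Q) + (-1 * ω ‖p.2‖ + -1 * ω ‖p.1‖)) := by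
        refine mul_le_mul_of_nonneg_left (Real.exp_le_exp.2 ?_) (by positivity)
        have e3 := mul_le_mul_of_nonneg_left (h3.trans (add_le_add_left h2 _)) hL0.le
        have e4 := mul_le_mul_of_nonneg_left (h4.trans (add_le_add_left h1 _)) hL0.le
        have e5 := mul_le_mul_of_nonneg_right (le_abs_self m) n2
        have e6 : L * ω ‖p.2‖ = |m| * ω ‖p.2‖ + 2 * ω ‖p.2‖ := by rw [hL]; ring
        have e7 : L * ω ‖p.1‖ = |m| * ω ‖p.1‖ + 2 * ω ‖p.1‖ := by rw [hL]; ring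
        have e8 := mul_nonneg (abs_nonneg m) n1
        linarith
    _ = _ := by rw [Real.exp_add, Real.exp_add]; ring

lemma contDiff_stftKernel (hω : IsWeightFunction ω) (ha : a ∈ symbolClass d ω m)
    (hφ : φ ∈ weightedSchwartz d ω) :
    ContDiff ℝ ∞ fun w : (E d × E d) × (E d × E d) => stftKernel φ a w.1 w.2 := by
  have h := (locallyDominated_kernelIntegrand hω ha hφ).contDiff (contDiff_kernelIntegrand ha.1)
  have e : ContDiff ℝ ∞ fun w : (E d × E d) × (E d × E d) => (inner ℝ w.2.1 w.2.2 : ℝ) :=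
    (contDiff_fst.comp contDiff_snd).inner ℝ (contDiff_snd.comp contDiff_snd)
  exact (contDiff_const.mul
    (contDiff_const.mul (Complex.ofRealCLM.contDiff.comp e)).cexp).mul h

end Smoothness

/-! ### Separation of cones -/

section Cone

/-- Points outside an open cone are quantitatively separated from a smaller cone. -/
lemma exists_norm_le_mul_norm_sub {Γ Γ' : Set (PhaseSpace d)} (hΓ : IsOpenCone Γ)
    (hΓ' : IsOpenCone Γ') (h : closure (Γ' ∩ Metric.sphere 0 1) ⊆ Γ) :
    ∃ N : ℕ, ∀ z' ∈ Γ', ∀ p ∉ Γ, ‖z'‖ ≤ N * ‖p - z'‖ := by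
  have hK : IsCompact (closure (Γ' ∩ Metric.sphere (0 : PhaseSpace d) 1)) :=
    (isCompact_sphere 0 1).closure_of_subset inter_subset_right
  -- Compactness gives a gap `δ` on the unit sphere, which scales by homogeneity. An integer `N ≥
  -- 1/δ` is chosen to suit subadditivity.
  obtain ⟨δ, hδ, hδ'⟩ := hK.exists_thickening_subset_open hΓ.isOpen h
  obtain ⟨N, hN⟩ := exists_nat_ge (1 / δ)
  refine ⟨N, fun z' hz' p hp => ?_⟩
  have hz0 : z' ≠ 0 := fun h0 => hΓ'.zero_notMem (h0 ▸ hz')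
  have hz : 0 < ‖z'‖ := norm_pos_iff.2 hz0
  have h1 : ‖z'‖⁻¹ • z' ∈ closure (Γ' ∩ Metric.sphere (0 : PhaseSpace d) 1) :=
    subset_closure ⟨hΓ'.smul_mem _ hz' _ (by positivity), by
      rw [mem_sphere_zero_iff_norm, norm_smul, norm_inv, norm_norm, inv_mul_cancel₀ hz.ne']⟩
  have h2 : ‖z'‖⁻¹ • p ∉ Γ := fun hmem => hp <| by
    have := hΓ.smul_mem _ hmem _ hz
    rwa [smul_smul, mul_inv_cancel₀ hz.ne', one_smul] at this
  have h3 : δ ≤ dist (‖z'‖⁻¹ • p) (‖z'‖⁻¹ • z') := by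
    by_contra! hlt
    exact h2 (hδ' (Metric.mem_thickening_iff.2 ⟨_, h1, hlt⟩))
  rw [dist_eq_norm, ← smul_sub, norm_smul, norm_inv, norm_norm, inv_mul_eq_div,
    le_div_iff₀ hz] at h3
  rw [div_le_iff₀ hδ] at hN
  nlinarith [norm_nonneg (p - z')]

lemma exists_cone_weight_le (hω : IsWeightFunction ω) {Γ Γ' : Set (PhaseSpace d)}
    (hΓ : IsOpenCone Γ) (hΓ' : IsOpenCone Γ') (h : closure (Γ' ∩ Metric.sphere 0 1) ⊆ Γ)
    {R : ℝ} (hR : 0 < R) {a : E d × E d → ℂ}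
    (ha : ∀ z ∈ Γ \ Metric.closedBall 0 R, a (z.fst, z.snd) = 0) :
    ∃ N D : ℝ, 0 ≤ N ∧ ∀ z' ∈ Γ', ∀ p : E d × E d, a p ≠ 0 →
      ω ‖z'.fst‖ + ω ‖z'.snd‖ ≤ N * (ω ‖p.1 - z'.fst‖ + ω ‖p.2 - z'.snd‖) + D := by
  obtain ⟨N, hN⟩ := exists_norm_le_mul_norm_sub hΓ hΓ' h
  -- The `2` comes from bounding each component of `z'` by `ω(|z'|)`; `N + 1` covers both `p ∉ Γ`
  -- and `|p| ≤ R`.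
  refine ⟨2 * (N + 1 : ℕ), 2 * ((N + 1 : ℕ) * ω R), by positivity, fun z' hz' p hp => ?_⟩
  set q : PhaseSpace d := WithLp.toLp 2 p with hq
  have h1 : ‖z'‖ ≤ (N + 1 : ℕ) * (‖q - z'‖ + R) := by
    have hN0 : (0 : ℝ) ≤ N := N.cast_nonneg
    have hn := norm_nonneg (q - z')
    push_cast
    by_cases hqΓ : q ∈ Γ
    · have hqR : ‖q‖ ≤ R := by
        by_contra! hlt
        exact hp (ha q ⟨hqΓ, by simpa using hlt⟩)
      have := norm_le_norm_add_norm_sub q z'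
      nlinarith [mul_nonneg hN0 (add_nonneg hn hR.le)]
    · have := hN z' hz' q hqΓ
      nlinarith [mul_nonneg hN0 hR.le]
  have h2 : ‖q - z'‖ ≤ ‖p.1 - z'.fst‖ + ‖p.2 - z'.snd‖ := by
    rw [WithLp.prod_norm_eq_of_L2]
    refine Real.sqrt_le_iff.2 ⟨by positivity, ?_⟩
    have : 0 ≤ ‖p.1 - z'.fst‖ * ‖p.2 - z'.snd‖ := by positivity
    change ‖p.1 - z'.fst‖ ^ 2 + ‖p.2 - z'.snd‖ ^ 2 ≤ _
    nlinarith
  have h3 : ω ‖z'‖ ≤ (N + 1 : ℕ) * (ω ‖p.1 - z'.fst‖ + ω ‖p.2 - z'.snd‖ + ω R) := by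
    refine (hω.mono (norm_nonneg _) (h1.trans (mul_le_mul_of_nonneg_left
      (add_le_add_left h2 R) (by positivity)))).trans ?_
    refine (hω.natCast_mul_le N (by positivity)).trans ?_
    gcongr
    refine (hω.subadditive _ _ (by positivity) hR.le).trans ?_
    gcongr
    exact hω.subadditive _ _ (norm_nonneg _) (norm_nonneg _)
  have h4 : ω ‖z'.fst‖ ≤ ω ‖z'‖ := hω.mono (norm_nonneg _) (WithLp.norm_fst_le (p := 2) _ z')
  have h5 : ω ‖z'.snd‖ ≤ ω ‖z'‖ := hω.mono (norm_nonneg _) (WithLp.norm_snd_le (p := 2) _ z')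
  linarith

end Cone

end

end

end OmegaSTFT

/-! ### The theorem, with `d = 0` treated apart -/

theorem mainTheorem6 (d : ℕ) (ω : ℝ → ℝ) (hω : IsWeightFunction ω)
    (m : ℝ) (a : E d × E d → ℂ) (ha : a ∈ symbolClass d ω m)
    (φ : 𝓢(E d, ℂ)) (hφ : φ ∈ weightedSchwartz d ω) (hφ_norm : ∫ x, ‖φ x‖ ^ 2 = 1) :
    (∀ z' z : E d × E d, Integrable (kernelIntegrand φ a z' z)) ∧
    ContDiff ℝ ((⊤ : ℕ∞) : WithTop ℕ∞) (fun p : (E d × E d) × (E d × E d) => stftKernel φ a p.1 p.2) ∧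
    (∀ l : ℝ, 0 < l → ∃ C : ℝ, 0 < C ∧ ∀ y' η' y η : E d,
      ‖stftKernel φ a (y', η') (y, η)‖ ≤
        C * Real.exp (-l * ω ‖y - y'‖) * Real.exp ((m - l) * ω ‖η - η'‖) *
          Real.exp (m * ω ‖η'‖)) ∧
    (∀ (Γ : Set (PhaseSpace d)) (R : ℝ), IsOpenCone Γ → 0 < R →
      (∀ z ∈ Γ \ Metric.closedBall 0 R, a (z.fst, z.snd) = 0) →
      ∀ Γ' : Set (PhaseSpace d), IsOpenCone Γ' → closure (Γ' ∩ Metric.sphere 0 1) ⊆ Γ →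
      ∀ l : ℝ, 0 < l → ∃ C : ℝ, 0 < C ∧ ∀ z' ∈ Γ', ∀ z : PhaseSpace d,
        ‖stftKernel φ a (z'.fst, z'.snd) (z.fst, z.snd)‖ ≤
          C * Real.exp (-l * ω ‖z.fst - z'.fst‖) * Real.exp (-l * ω ‖z.snd - z'.snd‖) *
            Real.exp (-2 * l * ω ‖z'.fst‖) * Real.exp (-2 * l * ω ‖z'.snd‖)) := by
  refine ⟨integrable_kernelIntegrand hω ha hφ, contDiff_stftKernel hω ha hφ, ?_, ?_⟩
  · intro l hl
    rcases Nat.eq_zero_or_pos d with rfl | hd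
    -- In dimension `0` there is no coordinate to test, but phase space is a single point and any
    -- bound holds with a suitable constant.
    · set r := Real.exp (-l * ω ‖(0 : E 0)‖) * Real.exp ((m - l) * ω ‖(0 : E 0)‖) *
        Real.exp (m * ω ‖(0 : E 0)‖) with hr
      have hr0 : 0 < r := by positivity
      refine ⟨(‖stftKernel φ a 0 0‖ + 1) / r, by positivity, fun y' η' y η => ?_⟩
      rw [Subsingleton.elim (y', η') 0, Subsingleton.elim (y, η) 0, Subsingleton.elim (y - y') 0,
        Subsingleton.elim (η - η') 0, Subsingleton.elim η' 0, mul_assoc, mul_assoc, ← mul_assoc _ _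
        (Real.exp (m * _)), ← hr, div_mul_cancel₀ _ hr0.ne']
      linarith
    · have : NeZero d := ⟨hd.ne'⟩
      obtain ⟨C, hC, h⟩ := exists_stftKernel_le hω ha hφ hl
      refine ⟨C + 1, by positivity, fun y' η' y η => (h y' η' y η).trans ?_⟩
      rw [Real.exp_add, Real.exp_add, ← mul_assoc, ← mul_assoc]
      gcongr
      linarith
  · intro Γ R hΓ hR hΓa Γ' hΓ' hcl l hl
    rcases Nat.eq_zero_or_pos d with rfl | hd
    -- Phase space is `{0}` and cones omit the origin, so `Γ'` is empty.
    · refine ⟨1, one_pos, fun z' hz' => absurd hz' ?_⟩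
      rw [show z' = 0 from norm_eq_zero.1 (by
        simp [WithLp.prod_norm_eq_of_L2, Subsingleton.elim (WithLp.fst z') 0,
          Subsingleton.elim (WithLp.snd z') 0])]
      exact hΓ'.zero_notMem
    · have : NeZero d := ⟨hd.ne'⟩
      obtain ⟨N, D, hN, hS⟩ := exists_cone_weight_le hω hΓ hΓ' hcl hR hΓa
      obtain ⟨C, hC, h⟩ := exists_stftKernel_le_cone hω ha hφ
        ((fun z : PhaseSpace d => (z.fst, z.snd)) '' Γ') (N := N) (D := D) hN
        (by rintro _ ⟨z', hz', rfl⟩ p hp; exact hS z' hz' p hp) hl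
      refine ⟨C + 1, by positivity, fun z' hz' z =>
        (h _ (mem_image_of_mem _ hz') (z.fst, z.snd)).trans ?_⟩
      rw [Real.exp_add, Real.exp_add, Real.exp_add, ← mul_assoc, ← mul_assoc, ← mul_assoc]
      gcongr
      linarith
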